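/- Let $(X,d)$ be a separable metric space, not necessarily complete, and let $\mathfrak m$ be a non-zero Radon measure on $X$ that is finite on bounded sets and doubling: there is $C_D\ge 1$ with $\mathfrak m(B_{2r}(z))\le C_D\,\mathfrak m(B_r(z))$ for all $z\in X$, $r>0$ (balls are open). Let $1\le p<\infty$ and $x,y\in X$. A chain is a finite sequence $\mathsf c=\{q_i\}_{i=0}^N$ of points of $X$, and an $\varepsilon$-chain if $d(q_i,q_{i+1})\le\varepsilon$ for all $i$. For $g\colon X\to[0,+\infty]$ put $\int_{\mathsf c}g=\sum_{i=0}^{N-1}\frac{g(q_i)+g(q_{i+1})}{2}\,d(q_i,q_{i+1})$, and $\ell(\mathsf c)=\int_{\mathsf c}1$. Let $\mathscr C_{x,y}$ be the family of chains with $q_0=x$, $q_N=y$, and $\mathscr C^\varepsilon_{x,y}$ the family of $\varepsilon$-chains in it. A Borel $g\colon X\to[0,+\infty]$ is an $\varepsilon$-upper gradient of $u\colon X\to\mathbb R$, written $g\in \mathrm{UG}^\varepsilon(u)$, if $|u(q_N)-u(q_0)|\le\int_{\mathsf c}g$ for every $\varepsilon$-chain $\mathsf c$. Let $\mathrm{Lip}(X)$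 be the set of Lipschitz functions $X\to\mathbb R$ and, for $u \in \mathrm{Lip}(X)$, $\mathrm{lip}\,u(z)=\lim_{\varepsilon\to0}\sup_{w\in B_\varepsilon(z)\setminus\{z\}}\frac{|u(w)-u(z)|}{d(w,z)}$ (the supremum of the empty set being $0$). For $L\ge1$ let $\mathfrak m^L_{x,y}=R^L_{x,y}\,\mathfrak m$, where $$R^L_{x,y}(z)=\frac{d(x,z)}{\mathfrak m(B_{d(x,z)}(x))}+\frac{d(y,z)}{\mathfrak m(B_{d(y,z)}(y))}\qquad\text{if } z\in \big(B_{Ld(x,y)}(x)\cup B_{Ld(x,y)}(y)\big)\setminus\{x,y\},$$ and $R^L_{x,y}(z)=0$ otherwise. For a family $\mathcal F$ of Borel functions, let $$\mathrm{Mod}^\varepsilon_p(\mathscr C_{x,y},\mathcal F,\mathfrak m^L_{x,y})=\inf\Big\{\int\rho^p\,d\mathfrak m^L_{x,y}\ :\ \rho\in\mathcal F,\ \rho\ge0 \text{ Borel},\ \int_{\mathsf c}\rho\ge1\ \text{ for all }\mathsf c\in\mathscr C^\varepsilon_{x,y}\Big\},$$ and let $\mathcal F_{x,y}$ be the family of Borel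 functions $g\colon X\to[0,+\infty]$ with $g(x),g(y)<+\infty$. Infima over the empty set are $+\infty$, and the conventions $0\cdot\infty=0$, $0^0=1$, and $0^{a}=+\infty$ for $a<0$, are used. Then the following four conditions are equivalent. (i) There exist $C>0$ and $L\ge1$ such that for every $u\in\mathrm{Lip}(X)$ $$|u(x)-u(y)|^p\le C\,d(x,y)^{p-1}\int(\mathrm{lip}\,u)^p\,d\mathfrak m^L_{x,y}.$$ (ii) There exist $C>0$ and $L\ge1$ such that for every Borel $g\colon X\to[0,+\infty]$ with $g(x),g(y)<+\infty$ $$\lim_{\varepsilon\to0}\ \inf_{\mathsf c\in\mathscr C^\varepsilon_{x,y},\ \ell(\mathsf c)\le C d(x,y)}\Big(\int_{\mathsf c}g\Big)^p\le C\,d(x,y)^{p-1}\int g^p\,d\mathfrak m^L_{x,y}.$$ (iii) There exist $C>0$ and $L\ge1$ such that for every Borel $u\colon X\to\mathbb R$, every $\varepsilon>0$ and every $g\in\mathrm{UG}^\varepsilon(u)$ with $g(x),g(y)<+\infty$ $$|u(x)-u(y)|^p\le C\,d(x,y)^{p-1}\int g^p\,d\mathfrak m^L_{x,y}.$$ (iv)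 There exist $c>0$ and $L\ge1$ such that $$\lim_{\varepsilon\to0}\mathrm{Mod}^\varepsilon_p(\mathscr C_{x,y},\mathcal F_{x,y},\mathfrak m^L_{x,y})=\lim_{\varepsilon\to0}\mathrm{Mod}^\varepsilon_p(\mathscr C_{x,y},\mathrm{Lip}(X),\mathfrak m^L_{x,y})\ge c\,d(x,y)^{1-p}.$$ -/

import Mathlib

open MeasureTheory Filter Topology Set
open scoped ENNReal

noncomputable section

namespace ChainPI

/-- A chain: a finite sequence of points `q_0, …, q_N` with `N ≥ 0`. Every such sequence is an
`ε`-chain for some `ε > 0`, so this is the set of all chains of `X`. -/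
structure Chain (X : Type*) where
  N : ℕ
  pt : Fin (N + 1) → X

namespace Chain

variable {X : Type*} (c : Chain X)

/-- The starting point `q_0`. -/
def start : X := c.pt 0

/-- The final point `q_N`. -/
def final : X := c.pt (Fin.last c.N)

/-- `c` is an `ε`-chain: consecutive points have distance at most `ε`. -/
def IsEps [PseudoMetricSpace X] (ε : ℝ) : Prop :=
  ∀ i : Fin c.N, dist (c.pt i.castSucc) (c.pt i.succ) ≤ ε

/-- `∫_c g = ∑_{i < N} (g(q_i) + g(q_{i+1})) / 2 * d(q_i, q_{i+1})`, with `∞ * 0 = 0`. -/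
def integral [PseudoMetricSpace X] (g : X → ℝ≥0∞) : ℝ≥0∞ :=
  ∑ i : Fin c.N, (g (c.pt i.castSucc) + g (c.pt i.succ)) / 2 *
    edist (c.pt i.castSucc) (c.pt i.succ)

/-- The length `∑_{i < N} d(q_i, q_{i+1})`. -/
def length [PseudoMetricSpace X] : ℝ≥0∞ :=
  ∑ i : Fin c.N, edist (c.pt i.castSucc) (c.pt i.succ)

end Chain

/-- The family of all chains from `x` to `y`. -/
def chainsBetween {X : Type*} (x y : X) : Set (Chain X) :=
  {c | c.start = x ∧ c.final = y}

/-- The `ε`-chains from `x` to `y` of length at most `ℓ`. -/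
def shortChains {X : Type*} [PseudoMetricSpace X] (ε : ℝ) (x y : X) (ℓ : ℝ) : Set (Chain X) :=
  {c | c ∈ chainsBetween x y ∧ c.IsEps ε ∧ c.length ≤ ENNReal.ofReal ℓ}

/-- The slope of `u` at scale `ε`: the supremum over `y ∈ B_ε(x)` of `|u y - u x| / d(y, x)`
(the term `y = x` is `0 / 0 = 0` in `ℝ≥0∞`). -/
def slope {X : Type*} [PseudoMetricSpace X] (ε : ℝ) (u : X → ℝ) (x : X) : ℝ≥0∞ :=
  ⨆ y ∈ Metric.ball x ε, ENNReal.ofReal |u y - u x| / edist y x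

/-- The local Lipschitz constant `lip u (x) = inf_{ε > 0} slope_ε u (x)`. -/
def lip {X : Type*} [PseudoMetricSpace X] (u : X → ℝ) (x : X) : ℝ≥0∞ :=
  ⨅ (ε : ℝ) (_ : 0 < ε), slope ε u x

/-- `g` is an `ε`-upper gradient of `u`. -/
def IsChainUpperGradient {X : Type*} [PseudoMetricSpace X] [MeasurableSpace X]
    (ε : ℝ) (u : X → ℝ) (g : X → ℝ≥0∞) : Prop :=
  Measurable g ∧
    ∀ c : Chain X, c.IsEps ε → ENNReal.ofReal |u c.final - u c.start| ≤ c.integral g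

/-- `m` is doubling: `m(B_{2r}(x)) ≤ C_D m(B_r(x))` for all `x` and all `r > 0`. -/
def IsDoubling {X : Type*} [PseudoMetricSpace X] [MeasurableSpace X] (m : Measure X) : Prop :=
  ∃ C_D : ℝ, 1 ≤ C_D ∧ ∀ (x : X) (r : ℝ), 0 < r →
    m (Metric.ball x (2 * r)) ≤ ENNReal.ofReal C_D * m (Metric.ball x r)

/-- The `L`-truncated Riesz kernel with poles at `x` and `y`: on `B_{L d(x,y)}(x) ∪ B_{L d(x,y)}(y)`
it is `d(x,z) / m(B_{d(x,z)}(x)) + d(y,z) / m(B_{d(y,z)}(y))`; it vanishes outside this set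
and at the poles. -/
def rieszKernel {X : Type*} [PseudoMetricSpace X] [MeasurableSpace X] (m : Measure X)
    (L : ℝ) (x y : X) : X → ℝ≥0∞ :=
  ((Metric.ball x (L * dist x y) ∪ Metric.ball y (L * dist x y)) \ {x, y}).indicator fun z =>
    edist x z / m (Metric.ball x (dist x z)) + edist y z / m (Metric.ball y (dist y z))

/-- The measure `m_{x,y}^L = R_{x,y}^L m`. -/
def rieszMeasure {X : Type*} [PseudoMetricSpace X] [MeasurableSpace X] (m : Measure X)
    (L : ℝ) (x y : X) : Measure X :=
  m.withDensity (rieszKernel m L x y)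

/-- The Borel functions `ρ ≥ 0` with `∫_c ρ ≥ 1` for every `ε`-chain `c` of the family `𝒞`. -/
def admissible {X : Type*} [PseudoMetricSpace X] [MeasurableSpace X]
    (ε : ℝ) (𝒞 : Set (Chain X)) : Set (X → ℝ≥0∞) :=
  {ρ | Measurable ρ ∧ ∀ c ∈ 𝒞, c.IsEps ε → 1 ≤ c.integral ρ}

/-- The `(ε, p)`-modulus of a family `𝒞` of chains with respect to a class `F` of functions
(`∞` if no admissible function lies in `F`). -/
def chainModulus {X : Type*} [PseudoMetricSpace X] [MeasurableSpace X]
    (p ε : ℝ) (𝒞 : Set (Chain X)) (F : Set (X → ℝ≥0∞)) (μ : Measure X) : ℝ≥0∞ :=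
  ⨅ ρ ∈ admissible ε 𝒞 ∩ F, ∫⁻ z, ρ z ^ p ∂μ

/-- The class of Borel functions `X → [0, ∞]` that are finite at `x` and at `y`. -/
def finiteAtPoles {X : Type*} [MeasurableSpace X] (x y : X) : Set (X → ℝ≥0∞) :=
  {g | Measurable g ∧ g x < ∞ ∧ g y < ∞}

/-- The class of non-negative real-valued Lipschitz functions. -/
def lipClass (X : Type*) [PseudoMetricSpace X] : Set (X → ℝ≥0∞) :=
  {g | ∃ f : X → ℝ, (∀ z, 0 ≤ f z) ∧ (∃ K, LipschitzWith K f) ∧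
    ∀ z, g z = ENNReal.ofReal (f z)}

end ChainPI

end

/-! For `x ≠ y` the conditions are linked in the cycle 1 → 4 → 2 → 3 → 1. Doubling enters only
through the finiteness of the Riesz measure: adding a small constant to a function then costs little
energy, and bounded sequences can be passed to the limit.

The core is 1 → 4, where a Borel function `g`, admissible at scale `ε` and finite at the poles, must
be replaced by a Lipschitz one of nearly the same energy. Compactness of curves is not available.
Instead (`exists_lipschitz_le_of_admissible`), add a constant to `g` and take a steep Lipschitz
inf-convolution `F` of its truncation. The lower bound forces any chain with small `F`-integral to
be short, so it can be sampled at a number `n` of points fixed before the steepness. Moving each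
sample to a near-minimizer of the inf-convolution gives an `ε`-chain along which the original
function has integral below 1, a contradiction. Finiteness at the poles controls the two end terms.
The price is a smaller `ε'`, invisible in the limit, so both moduli have the same limit. The
truncated chain distance with weight `F` is Lipschitz, separates the poles by 1 and has `lip` at
most `F`; testing 1 with it bounds the modulus below.

For 4 → 2, a multiple of `g + l` with energy below the modulus cannot be admissible, and the chain
that witnesses this has both small `g`-integral and bounded length. 2 → 3 is the definition of a
chain upper gradient, and 3 → 1 uses slopes at positive scale as chain upper gradients and lets the
scale tend to 0. -/

namespace ChainPI

/-! ### Finiteness of the Riesz measure -/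

section Riesz

variable {X : Type*} [PseudoMetricSpace X] [MeasurableSpace X]

theorem measurable_edist_div_measure_ball [OpensMeasurableSpace X] (m : Measure X) (x : X) :
    Measurable fun z => edist x z / m (Metric.ball x (dist x z)) := by
  have h : Monotone fun r : ℝ => m (Metric.ball x r) := fun r s hrs =>
    measure_mono (Metric.ball_subset_ball hrs)
  have h1 : Measurable fun z => edist x z := measurable_edist_right
  have h2 : Measurable fun z => dist x z := (continuous_const.dist continuous_id).measurable
  exact h1.div (h.measurable.comp h2)

/-- The Riesz potential of a ball at its centre is finite for a doubling measure. -/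
theorem setLIntegral_ball_edist_div_lt_top [OpensMeasurableSpace X] {m : Measure X}
    (hmd : IsDoubling m) (x : X) (R : ℝ) :
    ∫⁻ z in Metric.ball x R, edist x z / m (Metric.ball x (dist x z)) ∂m < ∞ := by
  obtain ⟨C, -, hC⟩ := hmd
  rcases le_or_gt R 0 with hR | hR
  · simp [Metric.ball_eq_empty.2 hR]
  set f : X → ℝ≥0∞ := fun z => edist x z / m (Metric.ball x (dist x z)) with hf
  set Z : Set X := {z | dist x z = 0} with hZdef
  set A : ℕ → Set X := fun k => {z | R / 2 ^ (k + 1) ≤ dist x z ∧ dist x z < R / 2 ^ k} with hA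
  have hd : Measurable fun z => dist x z := (continuous_const.dist continuous_id).measurable
  have hAm : ∀ k, MeasurableSet (A k) := fun k =>
    (measurableSet_le measurable_const hd).inter (measurableSet_lt hd measurable_const)
  have hZm : MeasurableSet Z := hd (measurableSet_singleton 0)
  have hsub : Metric.ball x R ⊆ Z ∪ ⋃ k, A k := by
    intro z hz
    rw [Metric.mem_ball, dist_comm] at hz
    rcases (dist_nonneg (x := x) (y := z)).eq_or_lt with h0 | h0
    · exact Or.inl h0.symm
    · right
      -- The powers trap the ratio in an interval closed on the right, whereas the annuli are closed
      -- on the left; at equality the index drops by one.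
      obtain ⟨n, hn1, hn2⟩ := exists_nat_pow_near_of_lt_one (x := dist x z / R) (y := 1 / 2)
        (by positivity) ((div_le_one hR).2 hz.le) (by norm_num) (by norm_num)
      rw [lt_div_iff₀ hR] at hn1
      rw [div_le_iff₀ hR] at hn2
      rcases hn2.lt_or_eq with h | h
      · refine mem_iUnion.2 ⟨n, ?_, ?_⟩
        · rw [div_eq_inv_mul, ← inv_pow]; simpa using hn1.le
        · rw [div_eq_inv_mul, ← inv_pow]; simpa using h
      · cases n with
        | zero => simp at h; linarith
        | succ n =>
          refine mem_iUnion.2 ⟨n, ?_, ?_⟩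
          · rw [h, div_eq_inv_mul, ← inv_pow]; simp
          · have h1 : (0 : ℝ) < (1 / 2) ^ n * R := by positivity
            have h2 : R / 2 ^ n = (1 / 2) ^ n * R := by
              rw [one_div, inv_pow, div_eq_inv_mul]
            rw [h, h2, pow_succ]
            linarith
  have hZ : ∫⁻ z in Z, f z ∂m = 0 := by
    rw [setLIntegral_congr_fun (g := fun _ => 0) hZm]
    · simp
    · intro z hz
      simp only [hf]
      rw [edist_dist, show dist x z = 0 from hz]
      simp
  have hk : ∀ k, ∫⁻ z in A k, f z ∂m ≤ ENNReal.ofReal (C * R) * ENNReal.ofReal ((1 / 2) ^ k) := by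
    intro k
    set s := R / 2 ^ (k + 1) with hs
    have hs0 : 0 < s := by positivity
    have h2s : R / 2 ^ k = 2 * s := by rw [hs, pow_succ]; field_simp
    have h1 : ∫⁻ z in A k, f z ∂m ≤
        ∫⁻ z in A k, ENNReal.ofReal (R / 2 ^ k) / m (Metric.ball x s) ∂m := by
      refine setLIntegral_mono' (hAm k) fun z hz => ?_
      simp only [hf]
      rw [edist_dist]
      exact ENNReal.div_le_div (ENNReal.ofReal_le_ofReal hz.2.le)
        (measure_mono (Metric.ball_subset_ball hz.1))
    refine h1.trans ?_
    rw [setLIntegral_const]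
    -- The annulus lies in the ball of radius `2 * s`, so doubling cancels the denominator and
    -- leaves a multiple of its radius: a geometric series.
    have h3 : m (A k) ≤ ENNReal.ofReal C * m (Metric.ball x s) := by
      refine le_trans (measure_mono ?_) (hC x s hs0)
      intro z hz
      rw [Metric.mem_ball, dist_comm, ← h2s]
      exact hz.2
    calc ENNReal.ofReal (R / 2 ^ k) / m (Metric.ball x s) * m (A k)
        ≤ ENNReal.ofReal (R / 2 ^ k) / m (Metric.ball x s) *
          (ENNReal.ofReal C * m (Metric.ball x s)) := by gcongr
      _ = ENNReal.ofReal C * ENNReal.ofReal (R / 2 ^ k) *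
          ((m (Metric.ball x s))⁻¹ * m (Metric.ball x s)) := by rw [div_eq_mul_inv]; ring
      _ ≤ ENNReal.ofReal C * ENNReal.ofReal (R / 2 ^ k) * 1 := by
          gcongr; exact ENNReal.inv_mul_le_one _
      _ = ENNReal.ofReal (C * R) * ENNReal.ofReal ((1 / 2) ^ k) := by
          rw [mul_one, ENNReal.ofReal_mul' hR.le, mul_assoc, ← ENNReal.ofReal_mul hR.le]
          congr 2
          rw [div_eq_mul_inv, one_div, inv_pow]
  calc ∫⁻ z in Metric.ball x R, f z ∂m ≤ ∫⁻ z in Z ∪ ⋃ k, A k, f z ∂m := lintegral_mono_set hsub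
    _ ≤ ∫⁻ z in Z, f z ∂m + ∫⁻ z in ⋃ k, A k, f z ∂m := lintegral_union_le _ _ _
    _ ≤ 0 + ∑' k, ∫⁻ z in A k, f z ∂m := add_le_add hZ.le (lintegral_iUnion_le _ _)
    _ ≤ 0 + ∑' k : ℕ, ENNReal.ofReal (C * R) * ENNReal.ofReal ((1 / 2) ^ k) := by
        gcongr with k; exact hk k
    _ < ∞ := by
        rw [zero_add, ENNReal.tsum_mul_left]
        refine ENNReal.mul_lt_top ENNReal.ofReal_lt_top ?_
        rw [← ENNReal.ofReal_tsum_of_nonneg (fun _ => by positivity) summable_geometric_two]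
        exact ENNReal.ofReal_lt_top

theorem isFiniteMeasure_rieszMeasure [OpensMeasurableSpace X] {m : Measure X}
    (hmd : IsDoubling m) (L : ℝ) (x y : X) : IsFiniteMeasure (rieszMeasure m L x y) := by
  refine ⟨?_⟩
  rw [rieszMeasure, withDensity_apply _ MeasurableSet.univ, Measure.restrict_univ]
  set D := dist x y
  have hD : 0 ≤ D := dist_nonneg
  -- Enlarging by `D` puts both truncation balls inside the ball of radius `R` about either pole, so
  -- each summand is integrated around its own pole.
  set R := L * D + D with hR
  set B := Metric.ball x R ∩ Metric.ball y R
  have hle : ∀ z, rieszKernel m L x y z ≤ B.indicator (fun z =>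
      edist x z / m (Metric.ball x (dist x z)) + edist y z / m (Metric.ball y (dist y z))) z := by
    refine indicator_le_indicator_of_subset ?_ (fun _ => zero_le)
    rintro z ⟨hz, -⟩
    simp only [mem_union, Metric.mem_ball] at hz
    refine ⟨?_, ?_⟩ <;> rw [Metric.mem_ball] <;>
      rcases hz with hz | hz
    · linarith
    · linarith [dist_triangle z y x, dist_comm x y]
    · linarith [dist_triangle z x y]
    · linarith
  refine (lintegral_mono hle).trans_lt ?_
  rw [lintegral_indicator (Metric.isOpen_ball.inter Metric.isOpen_ball).measurableSet,
    lintegral_add_left (measurable_edist_div_measure_ball m x)]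
  exact ENNReal.add_lt_top.2
    ⟨(lintegral_mono_set inter_subset_left).trans_lt (setLIntegral_ball_edist_div_lt_top hmd x R),
    (lintegral_mono_set inter_subset_right).trans_lt (setLIntegral_ball_edist_div_lt_top hmd y R)⟩

end Riesz

/-! ### Slopes as chain upper gradients -/

section Slope

variable {X : Type*} [MetricSpace X]

/-- A competitor `w` stays in the ball when the centre moves slightly, and its quotient varies
continuously. This is the source of measurability of the slope. -/
theorem lowerSemicontinuous_slope {u : X → ℝ} (hu : Continuous u) (ε : ℝ) :
    LowerSemicontinuous (slope ε u) := by
  intro z a ha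
  simp only [slope, lt_iSup_iff] at ha
  obtain ⟨w, hw, hlt⟩ := ha
  have hne : w ≠ z := by
    rintro rfl
    simp at hlt
  have hc : Tendsto (fun z' => ENNReal.ofReal |u w - u z'| / edist w z') (𝓝 z)
      (𝓝 (ENNReal.ofReal |u w - u z| / edist w z)) := by
    refine ENNReal.Tendsto.div ?_ (Or.inr (edist_pos.2 hne).ne') ?_ (Or.inl (edist_ne_top _ _))
    · exact (ENNReal.continuous_ofReal.comp (continuous_const.sub hu).abs).tendsto z
    · exact (continuous_const.edist continuous_id).tendsto z
  have hb : ∀ᶠ z' in 𝓝 z, w ∈ Metric.ball z' ε := by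
    have : Metric.ball w ε ∈ 𝓝 z := Metric.isOpen_ball.mem_nhds (by
      rw [Metric.mem_ball, dist_comm]; exact hw)
    filter_upwards [this] with z' hz'
    rw [Metric.mem_ball, dist_comm]; exact hz'
  filter_upwards [hc.eventually (lt_mem_nhds hlt), hb] with z' h1 h2
  exact h1.trans_le (le_iSup₂ (f := fun w (_ : w ∈ Metric.ball z' ε) =>
    ENNReal.ofReal |u w - u z'| / edist w z') w h2)

theorem slope_mono (u : X → ℝ) (z : X) : Monotone fun ε => slope ε u z := fun _ _ h =>
  biSup_mono fun _ hw => Metric.ball_subset_ball h hw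

theorem slope_le_of_lipschitz {u : X → ℝ} {K : NNReal} (hu : LipschitzWith K u) (ε : ℝ) (z : X) :
    slope ε u z ≤ K := by
  refine iSup₂_le fun w _ => ENNReal.div_le_of_le_mul ?_
  have := hu w z
  rwa [edist_dist (u w), Real.dist_eq] at this

theorem abs_sub_le_slope_mul {u : X → ℝ} {ε : ℝ} {z w : X} (h : dist z w < ε) :
    ENNReal.ofReal |u w - u z| ≤ slope ε u z * edist z w := by
  rcases eq_or_ne w z with rfl | hne
  · simp
  · rw [edist_comm]
    refine (ENNReal.div_le_iff_le_mul (Or.inl (edist_pos.2 hne).ne')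
      (Or.inl (edist_ne_top _ _))).1 ?_
    exact le_iSup₂ (f := fun w (_ : w ∈ Metric.ball z ε) =>
      ENNReal.ofReal |u w - u z| / edist w z) w (by rwa [Metric.mem_ball, dist_comm])

theorem Chain.abs_sub_le_integral {u : X → ℝ} {g : X → ℝ≥0∞} (c : Chain X)
    (h : ∀ i : Fin c.N, ENNReal.ofReal |u (c.pt i.succ) - u (c.pt i.castSucc)| ≤
      (g (c.pt i.castSucc) + g (c.pt i.succ)) / 2 * edist (c.pt i.castSucc) (c.pt i.succ)) :
    ENNReal.ofReal |u c.final - u c.start| ≤ c.integral g := by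
  obtain ⟨N, q⟩ := c
  simp only [Chain.final, Chain.start, Chain.integral] at *
  refine le_trans ?_ (Finset.sum_le_sum fun i _ => h i)
  clear h
  induction N with
  | zero => simp
  | succ N ih =>
    rw [Fin.sum_univ_castSucc]
    have := ih (fun i => q i.castSucc)
    simp only [Fin.castSucc_zero] at this
    calc ENNReal.ofReal |u (q (Fin.last (N + 1))) - u (q 0)|
        ≤ ENNReal.ofReal (|u (q (Fin.last N).castSucc) - u (q 0)| +
          |u (q (Fin.last (N + 1))) - u (q (Fin.last N).castSucc)|) := by
          apply ENNReal.ofReal_le_ofReal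
          linarith [abs_sub_le (u (q (Fin.last (N + 1)))) (u (q (Fin.last N).castSucc)) (u (q 0))]
      _ ≤ _ := by
          rw [ENNReal.ofReal_add (abs_nonneg _) (abs_nonneg _)]
          exact add_le_add this le_rfl

/-- On each edge the increment is bounded by the slope at either end times the length, hence by the
average of the two. Strictness `ε' < ε` is needed because chain steps are closed conditions and
slopes use open balls. -/
theorem isChainUpperGradient_slope [MeasurableSpace X] [BorelSpace X] {u : X → ℝ}
    (hu : Continuous u) {ε ε' : ℝ} (h : ε' < ε) : IsChainUpperGradient ε' u (slope ε u) := by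
  refine ⟨(lowerSemicontinuous_slope hu ε).measurable, fun c hc => c.abs_sub_le_integral ?_⟩
  intro i
  have hd := (hc i).trans_lt h
  have h1 := abs_sub_le_slope_mul (u := u) hd
  have h2 := abs_sub_le_slope_mul (u := u) ((dist_comm _ _).trans_lt hd)
  rw [abs_sub_comm, edist_comm] at h2
  set a := ENNReal.ofReal |u (c.pt i.succ) - u (c.pt i.castSucc)|
  rw [ENNReal.div_eq_inv_mul, mul_assoc, add_mul, ← ENNReal.div_eq_inv_mul,
    ENNReal.le_div_iff_mul_le (by simp) (by simp), mul_two]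
  exact add_le_add h1 h2

end Slope

/-! ### Sampling of chains and Lipschitz approximation of admissible functions -/

/-- Parametrization of a chain by `[0, ℓ)`: each edge is split in halves, which are sent to its
two end points. The integral of `f` over the chain becomes an integral over `[0, ℓ)`. -/
theorem exists_parametrization {X : Type*} [PseudoMetricSpace X] (f : X → ℝ≥0∞) (N : ℕ)
    (q : Fin (N + 1) → X) {ε : ℝ}
    (hq : ∀ i : Fin N, dist (q i.castSucc) (q i.succ) ≤ ε) :
    ∃ (φ : ℝ → X) (ℓ : ℝ), 0 ≤ ℓ ∧ (Chain.mk N q).length = ENNReal.ofReal ℓ ∧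
      (Measurable fun s => f (φ s)) ∧
      (∫⁻ s in Ico 0 ℓ, f (φ s)) = (Chain.mk N q).integral f ∧
      (∀ s t, 0 ≤ s → s ≤ t → t < ℓ → dist (φ s) (φ t) ≤ t - s + ε) ∧
      (∀ s, 0 ≤ s → s < ℓ → dist (q 0) (φ s) ≤ s + ε) ∧
      (∀ s, 0 ≤ s → s < ℓ → dist (φ s) (q (Fin.last N)) ≤ ℓ - s + ε / 2) ∧
      dist (q 0) (q (Fin.last N)) ≤ ℓ := by
  induction N with
  | zero =>
    refine ⟨fun _ => q 0, 0, le_rfl, by simp [Chain.length], measurable_const,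
      by simp [Chain.integral], ?_, ?_, ?_, by simp⟩
    · intro s t hs hst ht; linarith
    · intro s hs ht; linarith
    · intro s hs ht; linarith
  | succ N ih =>
    obtain ⟨φ, ℓ, hℓ, hlen, hmeas, hint, hst, hs0, hsl, hD⟩ :=
      ih (fun i => q i.castSucc) fun i => hq i.castSucc
    simp only [Fin.castSucc_zero] at hs0 hD
    set a := q (Fin.last N).castSucc with ha
    set b := q (Fin.last (N + 1)) with hb
    set d := dist a b with hd
    have hd0 : 0 ≤ d := dist_nonneg
    have hdε : d ≤ ε := hq (Fin.last N)
    have hed : edist a b = ENNReal.ofReal d := edist_dist a b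
    refine ⟨fun s => if s < ℓ then φ s else if s < ℓ + d / 2 then a else b, ℓ + d, by positivity,
      ?_, ?_, ?_, ?_, ?_, ?_, ?_⟩
    · rw [ENNReal.ofReal_add hℓ hd0, ← hlen, ← hed]
      simp only [Chain.length]
      rw [Fin.sum_univ_castSucc]
      rfl
    · have : (fun s => f (if s < ℓ then φ s else if s < ℓ + d / 2 then a else b)) =
          fun s => if s < ℓ then f (φ s) else if s < ℓ + d / 2 then f a else f b := by
        funext s; split_ifs <;> rfl
      rw [this]
      exact Measurable.ite measurableSet_Iio hmeas
        (Measurable.ite measurableSet_Iio measurable_const measurable_const)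
    · have h1 : Ico (0 : ℝ) (ℓ + d) = Ico 0 ℓ ∪ (Ico ℓ (ℓ + d / 2) ∪ Ico (ℓ + d / 2) (ℓ + d)) := by
        rw [Ico_union_Ico_eq_Ico (by linarith) (by linarith),
          Ico_union_Ico_eq_Ico hℓ (by linarith)]
      rw [h1, lintegral_union (measurableSet_Ico.union measurableSet_Ico), lintegral_union
        measurableSet_Ico]
      rotate_left
      · rw [Set.disjoint_left]; rintro s ⟨_, h⟩ ⟨h', _⟩; linarith
      · rw [Set.disjoint_left]; rintro s ⟨_, h⟩ (⟨h', _⟩ | ⟨h', _⟩) <;> linarith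
      rw [setLIntegral_congr_fun (g := fun s => f (φ s)) measurableSet_Ico,
        setLIntegral_congr_fun (s := Ico ℓ (ℓ + d / 2)) (g := fun _ => f a) measurableSet_Ico,
        setLIntegral_congr_fun (s := Ico (ℓ + d / 2) (ℓ + d)) (g := fun _ => f b)
          measurableSet_Ico, hint]
      · simp only [setLIntegral_const, Real.volume_Ico, Chain.integral]
        rw [Fin.sum_univ_castSucc]
        congr 1
        have e1 : ENNReal.ofReal (ℓ + d / 2 - ℓ) = edist a b / 2 := by
          rw [hed, ← ENNReal.ofReal_ofNat 2, ← ENNReal.ofReal_div_of_pos (by norm_num)]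
          congr 1; ring
        have e2 : ENNReal.ofReal (ℓ + d - (ℓ + d / 2)) = edist a b / 2 := by
          rw [hed, ← ENNReal.ofReal_ofNat 2, ← ENNReal.ofReal_div_of_pos (by norm_num)]
          congr 1; ring
        rw [e1, e2, ← add_mul, Fin.succ_last, ENNReal.div_eq_inv_mul, ENNReal.div_eq_inv_mul]
        ring
      · intro s hs
        have h2 : ¬ s < ℓ := by linarith [hs.1]
        have h3 : ¬ s < ℓ + d / 2 := by linarith [hs.1]
        simp [h2, h3]
      · intro s hs
        have h2 : ¬ s < ℓ := by linarith [hs.1]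
        simp [h2, hs.2]
      · intro s hs
        simp [hs.2]
    · intro s t hs hst' ht
      dsimp only
      split_ifs with h1 h2 h3 h4 h5 h6 h7 h8
      · exact hst s t hs hst' h2
      · have : dist (φ s) a ≤ _ := hsl s hs h1
        linarith
      -- Here the sharper `ε / 2` in the estimate to the end point is needed: the parameter has
      -- covered only `d / 2` of the jump `d`, and the other half uses up the remaining `ε / 2`.
      · have : dist (φ s) a ≤ _ := hsl s hs h1
        have := dist_triangle (φ s) a b
        linarith
      all_goals first | linarith | (simp; linarith)
    · intro s hs ht
      dsimp only
      split_ifs with h1 h2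
      · exact hs0 s hs h1
      · have : dist (q 0) a ≤ ℓ := hD
        linarith
      · have : dist (q 0) a ≤ ℓ := hD
        have := dist_triangle (q 0) a b
        linarith
    · intro s hs ht
      dsimp only
      split_ifs with h1 h2
      · have : dist (φ s) a ≤ _ := hsl s hs h1
        have := dist_triangle (φ s) a b
        linarith
      · linarith
      · simp; linarith
    · have : dist (q 0) a ≤ ℓ := hD
      have := dist_triangle (q 0) a b
      linarith

/-- Averaging over the translations of a grid. -/
theorem exists_grid_sum_le {F : ℝ → ℝ≥0∞} (hF : Measurable F) {η : ℝ} (hη : 0 < η) (n : ℕ) :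
    ∃ t ∈ Ico 0 η, ENNReal.ofReal η * ∑ k ∈ Finset.range n, F (t + k * η) ≤
      ∫⁻ s in Ico 0 (n * η), F s := by
  have hsum : ∫⁻ s in Ico 0 (n * η), F s =
      ∫⁻ t in Ico 0 η, ∑ k ∈ Finset.range n, F (t + k * η) := by
    rw [lintegral_finsetSum _ fun (k : ℕ) _ => show Measurable fun t => F (t + k * η) from
      hF.comp (measurable_id.add_const _)]
    induction n with
    | zero => simp
    | succ n ih =>
      rw [Finset.sum_range_succ, ← ih]
      have h1 : Ico (0 : ℝ) ((n + 1 : ℕ) * η) = Ico 0 (n * η) ∪ Ico (n * η) (η + n * η) := by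
        rw [Ico_union_Ico_eq_Ico (by positivity) (by linarith)]
        push_cast; ring_nf
      rw [h1, lintegral_union measurableSet_Ico]
      · congr 1
        have h2 := (measurePreserving_add_right (volume : Measure ℝ) (n * η)).setLIntegral_comp_preimage
          (s := Ico (n * η) (η + n * η)) measurableSet_Ico hF
        rw [← h2]
        congr 2
        ext s
        simp
      · rw [Set.disjoint_left]; rintro s ⟨_, h⟩ ⟨h', _⟩; linarith
  have hvol : volume (Ico (0 : ℝ) η) = ENNReal.ofReal η := by simp
  -- Some translation does at most as badly as the average.
  obtain ⟨t, ht, hle⟩ := exists_le_setLAverage (μ := volume) (s := Ico (0 : ℝ) η)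
    (f := fun t => ∑ k ∈ Finset.range n, F (t + k * η)) (by simpa using hη) (by simp)
    (Finset.measurable_fun_sum _ fun k _ => hF.comp (measurable_id.add_const _)).aemeasurable
  refine ⟨t, ht, ?_⟩
  rw [setLAverage_eq, hvol, ← hsum] at hle
  rw [mul_comm]
  exact (ENNReal.le_div_iff_mul_le (by left; simpa using hη) (by simp)).1 hle

/-- The Lipschitz regularization `z ↦ inf_w (min (f w) J + J d(z, w))`. -/
theorem exists_lipschitz_regularization {X : Type*} [PseudoMetricSpace X] (f : X → ℝ≥0∞)
    (J : NNReal) :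
    ∃ F : X → ℝ, LipschitzWith J F ∧ (∀ z, 0 ≤ F z) ∧ (∀ z, F z ≤ J) ∧
      (∀ z, ENNReal.ofReal (F z) ≤ f z) ∧
      (∀ δ : NNReal, δ ≤ J → (∀ w, (δ : ℝ≥0∞) ≤ f w) → ∀ z, (δ : ℝ) ≤ F z) ∧
      ∀ z τ, 0 < τ → F z + τ < J →
        ∃ w, f w ≤ ENNReal.ofReal (F z + τ) ∧ J * dist z w ≤ F z + τ := by
  set a : X → ℝ := fun w => (min (f w) J).toReal with ha
  have hatop : ∀ w, min (f w) (J : ℝ≥0∞) ≠ ∞ := fun w =>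
    ((min_le_right _ _).trans_lt ENNReal.coe_lt_top).ne
  have ha0 : ∀ w, 0 ≤ a w := fun w => ENNReal.toReal_nonneg
  have haJ : ∀ w, a w ≤ J := fun w =>
    ENNReal.toReal_le_of_le_ofReal J.2 (by simp)
  have hbdd : ∀ z, BddBelow (range fun w => a w + J * dist z w) := fun z =>
    ⟨0, by rintro _ ⟨w, rfl⟩; have := ha0 w; positivity⟩
  have hFa : ∀ z, (⨅ w, (a w + J * dist z w)) ≤ a z := fun z =>
    (ciInf_le (hbdd z) z).trans (by simp)
  refine ⟨fun z => ⨅ w, (a w + J * dist z w), ?_, ?_, ?_, ?_, ?_, ?_⟩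
  · refine LipschitzWith.of_le_add_mul J fun z z' => ?_
    have : Nonempty X := ⟨z⟩
    rw [← sub_le_iff_le_add]
    refine le_ciInf fun w => ?_
    rw [sub_le_iff_le_add]
    refine (ciInf_le (hbdd z) w).trans ?_
    have := mul_le_mul_of_nonneg_left (dist_triangle z z' w) J.2
    simp only [NNReal.val_eq_coe] at this
    linarith
  · intro z
    exact Real.iInf_nonneg fun w => by have := ha0 w; positivity
  · exact fun z => (hFa z).trans (haJ z)
  · intro z
    refine (ENNReal.ofReal_le_ofReal (hFa z)).trans ?_
    rw [ha, ENNReal.ofReal_toReal (hatop z)]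
    exact min_le_left _ _
  · intro δ hδ hf z
    have : Nonempty X := ⟨z⟩
    refine le_ciInf fun w => ?_
    have h1 : (δ : ℝ) ≤ a w := by
      rw [ha, ← ENNReal.coe_toReal]
      exact ENNReal.toReal_mono (hatop w) (le_min (hf w) (by exact_mod_cast hδ))
    have : 0 ≤ (J : ℝ) * dist z w := by positivity
    linarith
  · intro z τ hτ hJ
    have : Nonempty X := ⟨z⟩
    obtain ⟨w, hw⟩ := exists_lt_of_ciInf_lt (lt_add_of_pos_right
      (⨅ w, (a w + J * dist z w)) hτ)
    have hd : 0 ≤ (J : ℝ) * dist z w := by positivity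
    refine ⟨w, ?_, by linarith [ha0 w]⟩
    -- Below the level `J` the truncation is inactive, so the bound on `a w` is a bound on `f w`.
    have haw : a w < J := by linarith
    have h1 : min (f w) (J : ℝ≥0∞) < J := by
      rw [← ENNReal.toReal_lt_toReal (hatop w) ENNReal.coe_ne_top]
      simpa using haw
    have h2 : f w < J := by simpa using h1
    have h3 : f w = ENNReal.ofReal (a w) := by
      rw [ha, ENNReal.ofReal_toReal (hatop w), min_eq_left h2.le]
    rw [h3]
    exact ENNReal.ofReal_le_ofReal (by linarith)

theorem Chain.mul_length_le_integral {X : Type*} [PseudoMetricSpace X] (c : Chain X)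
    {g : X → ℝ≥0∞} {a : ℝ≥0∞} (h : ∀ z, a ≤ g z) : a * c.length ≤ c.integral g := by
  rw [Chain.length, Chain.integral, Finset.mul_sum]
  refine Finset.sum_le_sum fun i _ => ?_
  gcongr
  rw [ENNReal.le_div_iff_mul_le (by simp) (by simp), mul_two]
  exact add_le_add (h _) (h _)

/-- The chain `x, w_0, …, w_{n-1}, y` and an estimate of its integral. -/
theorem exists_chain_through {X : Type*} [PseudoMetricSpace X] {x y : X} (w : ℕ → X) {n : ℕ}
    (hn : 0 < n) {r : ℝ} (h0 : dist x (w 0) ≤ r) (hw : ∀ k, k + 1 < n → dist (w k) (w (k + 1)) ≤ r)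
    (hl : dist (w (n - 1)) y ≤ r) (f : X → ℝ≥0∞) :
    ∃ c ∈ chainsBetween x y, c.IsEps r ∧
      c.integral f ≤ ENNReal.ofReal r * (f x + f y + ∑ k ∈ Finset.range n, f (w k)) := by
  set v : ℕ → X := fun k => if k = 0 then x else if k = n + 1 then y else w (k - 1) with hv
  have hv0 : v 0 = x := by simp [hv]
  have hvl : v (n + 1) = y := by simp [hv]
  have hvk : ∀ k, k < n → v (k + 1) = w k := fun k hk => by simp [hv, hk.ne]
  have hstep : ∀ k, k < n + 1 → dist (v k) (v (k + 1)) ≤ r := by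
    intro k hk
    rcases Nat.eq_zero_or_pos k with rfl | hk0
    · rw [hv0, hvk 0 hn]; exact h0
    · obtain ⟨j, rfl⟩ := Nat.exists_eq_add_of_le' hk0
      rw [hvk j (by omega)]
      rcases (show j + 1 ≤ n by omega).lt_or_eq with h | h
      · rw [hvk (j + 1) h]; exact hw j h
      · subst h
        rw [hvl]; exact hl
  refine ⟨⟨n + 1, fun i => v i⟩, ⟨by simpa [Chain.start] using hv0,
    by simpa [Chain.final] using hvl⟩, fun i => hstep i i.2, ?_⟩
  calc Chain.integral ⟨n + 1, fun i => v i⟩ f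
      = ∑ i : Fin (n + 1), (f (v i) + f (v (i + 1))) / 2 * edist (v i) (v (i + 1)) := rfl
    _ = ∑ k ∈ Finset.range (n + 1), (f (v k) + f (v (k + 1))) / 2 * edist (v k) (v (k + 1)) :=
        Fin.sum_univ_eq_sum_range (fun k => (f (v k) + f (v (k + 1))) / 2 *
          edist (v k) (v (k + 1))) (n + 1)
    _ ≤ ∑ k ∈ Finset.range (n + 1), (f (v k) + f (v (k + 1))) / 2 * ENNReal.ofReal r := by
        refine Finset.sum_le_sum fun k hk => ?_
        gcongr
        rw [edist_dist]
        exact ENNReal.ofReal_le_ofReal (hstep k (Finset.mem_range.1 hk))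
    _ = ENNReal.ofReal r * ((∑ k ∈ Finset.range (n + 1), f (v k) +
          ∑ k ∈ Finset.range (n + 1), f (v (k + 1))) / 2) := by
        rw [← Finset.sum_mul, mul_comm, ← Finset.sum_add_distrib]
        simp only [div_eq_mul_inv, Finset.sum_mul]
    _ ≤ ENNReal.ofReal r * (f x + f y + ∑ k ∈ Finset.range n, f (w k)) := by
        gcongr
        have hS : ∑ k ∈ Finset.range n, f (v (k + 1)) = ∑ k ∈ Finset.range n, f (w k) :=
          Finset.sum_congr rfl fun k hk => by rw [hvk k (Finset.mem_range.1 hk)]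
        rw [Finset.sum_range_succ' (fun k => f (v k)), Finset.sum_range_succ (fun k => f (v (k + 1))),
          hS, hv0, hvl]
        refine ENNReal.div_le_of_le_mul ?_
        generalize ∑ k ∈ Finset.range n, f (w k) = S
        calc S + f x + (S + f y) = (f x + f y) + S * 2 := by ring
          _ ≤ (f x + f y) * 2 + S * 2 := by
            gcongr
            exact le_mul_of_one_le_right' one_le_two
          _ = (f x + f y + S) * 2 := by ring

/-- A function that is bounded below and admissible for the `ε`-chains from `x` to `y` is, up to
a factor `θ < 1`, approximated from below by a bounded Lipschitz function which is admissible
for the `ε'`-chains from `x` to `y` with some smaller `ε'`. -/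
theorem exists_lipschitz_le_of_admissible {X : Type*} [PseudoMetricSpace X] {x y : X}
    (hxy : 0 < dist x y) {ε : ℝ} (hε : 0 < ε) {f : X → ℝ≥0∞} (hfx : f x < ∞) (hfy : f y < ∞)
    {δ : NNReal} (hδ : 0 < δ) (hf : ∀ z, (δ : ℝ≥0∞) ≤ f z)
    (hadm : ∀ c ∈ chainsBetween x y, c.IsEps ε → 1 ≤ c.integral f) {θ : ℝ} (hθ0 : 0 < θ)
    (hθ : θ < 1) :
    ∃ (J : NNReal) (F : X → ℝ) (ε' : ℝ), 0 < ε' ∧ LipschitzWith J F ∧ (∀ z, 0 ≤ F z) ∧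
      (∀ z, F z ≤ J) ∧ (∀ z, ENNReal.ofReal (F z) ≤ f z) ∧
      ∀ c ∈ chainsBetween x y, c.IsEps ε' →
        ENNReal.ofReal θ ≤ c.integral fun z => ENNReal.ofReal (F z) := by
  set D := dist x y with hD
  set A : ℝ := (f x + f y).toReal with hA
  have hAtop : f x + f y ≠ ∞ := (ENNReal.add_lt_top.2 ⟨hfx, hfy⟩).ne
  have hA0 : 0 ≤ A := ENNReal.toReal_nonneg
  -- Bounds the length of every chain with `F`-integral below 1, since `F ≥ δ`.
  set Λ : ℝ := 1 / δ with hΛ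
  have hΛ0 : 0 < Λ := by positivity
  obtain ⟨n, hn0, hnε, hnA⟩ : ∃ n : ℕ, 0 < n ∧ Λ / n < ε ∧ θ + Λ / n * A < 1 := by
    have h1 : Tendsto (fun n : ℕ => Λ / n) atTop (𝓝 0) := tendsto_const_div_atTop_nhds_zero_nat Λ
    have h2 : Tendsto (fun n : ℕ => θ + Λ / n * A) atTop (𝓝 (θ + 0 * A)) :=
      (h1.mul_const A).const_add θ
    rw [zero_mul, add_zero] at h2
    exact ((eventually_gt_atTop 0).and ((h1.eventually (gt_mem_nhds hε)).and
      (h2.eventually (gt_mem_nhds hθ)))).exists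
  have hnpos : (0 : ℝ) < n := by exact_mod_cast hn0
  -- The last inequality is exactly the final budget: the first term bounds the sampled integral of
  -- `F` with step `η + σ`, the second the poles and the `n` errors `σ`.
  obtain ⟨σ, hσ0, hσε, hσ⟩ : ∃ σ : ℝ, 0 < σ ∧ Λ / n + σ < ε ∧
      θ * (1 + σ * (n / D)) + (Λ / n + σ) * (A + n * σ) < 1 := by
    have h1 : Tendsto (fun σ : ℝ => Λ / n + σ) (𝓝[>] 0) (𝓝 (Λ / n + 0)) :=
      (Continuous.tendsto (by fun_prop) 0).mono_left nhdsWithin_le_nhds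
    have h2 : Tendsto (fun σ : ℝ => θ * (1 + σ * (n / D)) + (Λ / n + σ) * (A + n * σ)) (𝓝[>] 0)
        (𝓝 (θ * (1 + 0 * (n / D)) + (Λ / n + 0) * (A + n * 0))) :=
      (Continuous.tendsto (by fun_prop) 0).mono_left nhdsWithin_le_nhds
    simp only [add_zero, zero_mul, mul_zero, mul_one] at h1 h2
    exact (eventually_mem_nhdsWithin.and ((h1.eventually (gt_mem_nhds hnε)).and
      (h2.eventually (gt_mem_nhds hnA)))).exists
  set M : ℝ := n / D + σ with hM
  have hM0 : 0 < M := by positivity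
  -- `M` will bound `F + σ` at the samples. The three summands give `M ≤ J * (σ / 4)`, so
  -- near-minimizers lie within `σ / 4`, then `M < J`, so the truncation is inactive, and `δ ≤ J`.
  set J : NNReal := ⟨M * (4 / σ + 1) + δ, by positivity⟩ with hJ
  have hJval : (J : ℝ) = M * (4 / σ + 1) + δ := rfl
  have hδ' : (0 : ℝ) < δ := by exact_mod_cast hδ
  have hMJ : M < J := by
    have : 0 < M * (4 / σ) := by positivity
    rw [hJval, mul_add]; linarith
  have hJσ : M ≤ J * (σ / 4) := by
    have : M * (4 / σ) * (σ / 4) = M := by field_simp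
    rw [hJval, mul_add, add_mul, add_mul, this]
    have : 0 ≤ M * 1 * (σ / 4) + δ * (σ / 4) := by positivity
    linarith
  have hJ0 : (0 : ℝ) < J := hM0.trans hMJ
  obtain ⟨F, hFL, hF0, hFJ, hFf, hFδ, hFw⟩ := exists_lipschitz_regularization f J
  have hδJ : δ ≤ J := by
    rw [← NNReal.coe_le_coe, hJval]
    have : 0 ≤ M * (4 / σ + 1) := by positivity
    linarith
  refine ⟨J, F, σ / 2, by positivity, hFL, hF0, hFJ, hFf, ?_⟩
  rintro ⟨N, q⟩ ⟨hqx, hqy⟩ hq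
  simp only [Chain.start, Chain.final] at hqx hqy
  by_contra! hlt
  obtain ⟨φ, ℓ, hℓ, hlen, hmeas, hint, hst, hs0, hsl, hDl⟩ :=
    exists_parametrization (fun z => ENNReal.ofReal (F z)) N q hq
  rw [hqx] at hs0
  rw [hqy] at hsl
  rw [hqx, hqy] at hDl
  have hℓ0 : 0 < ℓ := hxy.trans_le hDl
  have hℓΛ : ℓ ≤ Λ := by
    have h1 := Chain.mul_length_le_integral ⟨N, q⟩ (g := fun z => ENNReal.ofReal (F z))
      (a := ENNReal.ofReal δ) (fun z => ENNReal.ofReal_le_ofReal (hFδ δ hδJ hf z))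
    rw [hlen, ← ENNReal.ofReal_mul hδ'.le] at h1
    have h2 := (ENNReal.ofReal_lt_ofReal_iff hθ0).1 (h1.trans_lt hlt)
    rw [hΛ, le_div_iff₀ hδ']
    linarith
  set η := ℓ / n with hη
  have hη0 : 0 < η := by positivity
  have hnη : n * η = ℓ := by rw [hη]; field_simp
  obtain ⟨t, ht, hsum⟩ := exists_grid_sum_le hmeas hη0 n
  rw [hnη, hint] at hsum
  set S : ℝ := ∑ k ∈ Finset.range n, F (φ (t + k * η)) with hS
  have hηS : η * S ≤ θ := by
    have h1 := hsum.trans_lt hlt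
    rw [← ENNReal.ofReal_sum_of_nonneg fun _ _ => hF0 _, ← ENNReal.ofReal_mul hη0.le] at h1
    exact ((ENNReal.ofReal_lt_ofReal_iff hθ0).1 h1).le
  -- A chain from `x` to `y` has length at least `D`, so the grid is not too fine and the sum `S` is
  -- bounded independently of `J`.
  have hηD : 1 / η ≤ n / D := by
    rw [div_le_div_iff₀ hη0 hxy, hnη]; linarith
  have hS0 : 0 ≤ S := Finset.sum_nonneg fun _ _ => hF0 _
  have hSθ : S ≤ θ * (n / D) := by
    have h1 : S ≤ θ * (1 / η) := by
      rw [mul_one_div, le_div_iff₀ hη0]; linarith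
    exact h1.trans (mul_le_mul_of_nonneg_left hηD hθ0.le)
  have hFq : ∀ k, k < n → F (φ (t + k * η)) ≤ n / D := by
    intro k hk
    have h1 : F (φ (t + k * η)) ≤ S := Finset.single_le_sum
      (f := fun k : ℕ => F (φ (t + k * η))) (fun _ _ => hF0 _) (Finset.mem_range.2 hk)
    have h2 : θ * (n / D) ≤ 1 * (n / D) := by gcongr
    linarith
  have hex : ∀ k : ℕ, ∃ w, k < n → f w ≤ ENNReal.ofReal (F (φ (t + k * η)) + σ) ∧
      dist (φ (t + k * η)) w ≤ σ / 4 := by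
    intro k
    by_cases hk : k < n
    · obtain ⟨w, hw1, hw2⟩ := hFw (φ (t + k * η)) σ hσ0 (by linarith [hFq k hk])
      refine ⟨w, fun _ => ⟨hw1, ?_⟩⟩
      have h1 : J * dist (φ (t + k * η)) w ≤ J * (σ / 4) := by linarith [hFq k hk]
      exact le_of_mul_le_mul_left h1 hJ0
    · exact ⟨x, fun h => absurd h hk⟩
  choose w hw using hex
  have hgrid : ∀ k : ℕ, k < n → 0 ≤ t + k * η ∧ t + k * η < ℓ := by
    intro k hk
    have h1 : (k : ℝ) + 1 ≤ n := by exact_mod_cast hk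
    have h2 := mul_le_mul_of_nonneg_right h1 hη0.le
    rw [hnη] at h2
    refine ⟨by have := ht.1; positivity, by linarith [ht.2]⟩
  -- Between neighbours: `η` from the grid, `σ / 2` from the step size of the original chain, and `σ
  -- / 4` for each displaced sample.
  obtain ⟨c, hc, hcε, hcint⟩ := exists_chain_through (x := x) (y := y) w hn0 (r := η + σ)
    (by
      have h1 := hs0 _ (hgrid 0 hn0).1 (hgrid 0 hn0).2
      have h2 := (hw 0 hn0).2
      have h3 := dist_triangle x (φ (t + (0 : ℕ) * η)) (w 0)
      have h4 := ht.2
      push_cast at h1 h2 h3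
      linarith)
    (by
      intro k hk
      have hk' : k < n := by omega
      have h1 := hst _ (t + (k + 1 : ℕ) * η) (hgrid k hk').1
        (by push_cast; linarith) (hgrid (k + 1) hk).2
      have h2 := (hw k hk').2
      have h3 := (hw (k + 1) hk).2
      have h4 := dist_triangle4 (w k) (φ (t + k * η)) (φ (t + (k + 1 : ℕ) * η)) (w (k + 1))
      rw [dist_comm] at h2
      push_cast at h1 h2 h3 h4
      linarith)
    (by
      have hk : n - 1 < n := by omega
      have h1 := hsl _ (hgrid _ hk).1 (hgrid _ hk).2
      have h2 := (hw _ hk).2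
      have h3 := dist_triangle (w (n - 1)) (φ (t + (n - 1 : ℕ) * η)) y
      have h4 : ((n - 1 : ℕ) : ℝ) * η = ℓ - η := by
        rw [Nat.cast_sub hn0, sub_mul, hnη]; simp
      rw [dist_comm] at h2
      have h5 := ht.1
      linarith) f
  have hηΛ : η ≤ Λ / n := by rw [hη]; gcongr
  have h1 := (hadm c hc fun i => (hcε i).trans (by linarith)).trans hcint
  have h2 : f x + f y + ∑ k ∈ Finset.range n, f (w k) ≤ ENNReal.ofReal (A + (S + n * σ)) := by
    rw [ENNReal.ofReal_add hA0 (by positivity), hA, ENNReal.ofReal_toReal hAtop]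
    gcongr
    have h3 : S + n * σ = ∑ k ∈ Finset.range n, (F (φ (t + k * η)) + σ) := by
      rw [Finset.sum_add_distrib]; simp [hS]
    rw [h3, ENNReal.ofReal_sum_of_nonneg fun _ _ => add_nonneg (hF0 _) hσ0.le]
    exact Finset.sum_le_sum fun k hk => (hw k (Finset.mem_range.1 hk)).1
  have h3 : 1 ≤ (η + σ) * (A + (S + n * σ)) := by
    have := h1.trans (mul_le_mul_right h2 _)
    rw [← ENNReal.ofReal_mul (by positivity)] at this
    exact ENNReal.one_le_ofReal.1 this
  have h4 : (η + σ) * (A + n * σ) ≤ (Λ / n + σ) * (A + n * σ) := by gcongr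
  have h5 : σ * S ≤ σ * (θ * (n / D)) := by gcongr
  nlinarith

/-! ### Chain distances and monotonicity in the scale -/

section Chains

variable {X : Type*} [PseudoMetricSpace X]

theorem Chain.integral_mono (c : Chain X) {f g : X → ℝ≥0∞} (h : ∀ z, f z ≤ g z) :
    c.integral f ≤ c.integral g := by
  unfold Chain.integral
  gcongr <;> exact h _

theorem Chain.integral_const_mul (c : Chain X) (a : ℝ≥0∞) (g : X → ℝ≥0∞) :
    (c.integral fun z => a * g z) = a * c.integral g := by
  simp only [Chain.integral, Finset.mul_sum]
  refine Finset.sum_congr rfl fun i _ => ?_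
  rw [← mul_add, mul_div_assoc, mul_assoc]

theorem Chain.exists_append {x z : X} {ε : ℝ} {c : Chain X} (hc : c ∈ chainsBetween x z)
    (hcε : c.IsEps ε) {z' : X} (h : dist z z' ≤ ε) (g : X → ℝ≥0∞) :
    ∃ c' ∈ chainsBetween x z', c'.IsEps ε ∧
      c'.integral g = c.integral g + (g z + g z') / 2 * edist z z' := by
  obtain ⟨N, q⟩ := c
  obtain ⟨hx, hz⟩ := hc
  simp only [Chain.start, Chain.final] at hx hz
  have h1 : ∀ i : Fin (N + 1), Fin.snoc (α := fun _ => X) q z' i.castSucc = q i := fun i =>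
    Fin.snoc_castSucc (α := fun _ => X) z' q i
  have h2 : Fin.snoc (α := fun _ => X) q z' (Fin.last (N + 1)) = z' :=
    Fin.snoc_last (α := fun _ => X) z' q
  refine ⟨⟨N + 1, Fin.snoc (α := fun _ => X) q z'⟩, ⟨?_, h2⟩, ?_, ?_⟩
  · exact (h1 0).trans hx
  · intro i
    refine Fin.lastCases ?_ (fun j => ?_) i
    · simp only [Fin.succ_last]
      rw [h1, h2, hz]; exact h
    · simp only [Fin.succ_castSucc]
      rw [h1, h1]; exact hcε j
  · simp only [Chain.integral]
    rw [Fin.sum_univ_castSucc]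
    simp only [Fin.succ_castSucc, Fin.succ_last, h1]
    erw [h2]
    rw [hz]

/-- If a bounded Lipschitz function `F ≥ 0` is admissible for the `ε`-chains from `x` to `y`, then
there is a Lipschitz function with local Lipschitz constant at most `F` which separates `x`
from `y`: the truncated infimum of the integrals of `F` over `ε`-chains from `x`. -/
theorem exists_lipschitz_lip_le {x y : X} {F : X → ℝ} {J : NNReal} (hF : LipschitzWith J F)
    (hF0 : ∀ z, 0 ≤ F z) {M : NNReal} (hFM : ∀ z, F z ≤ M) {ε : ℝ} (hε : 0 < ε)
    (hadm : ∀ c ∈ chainsBetween x y, c.IsEps ε → 1 ≤ c.integral fun z => ENNReal.ofReal (F z)) :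
    ∃ u : X → ℝ, (∃ K, LipschitzWith K u) ∧ |u x - u y| = 1 ∧
      ∀ z, lip u z ≤ ENNReal.ofReal (F z) := by
  set G : X → ℝ≥0∞ := fun z => ENNReal.ofReal (F z) with hG
  set v : X → ℝ≥0∞ := fun z =>
    ⨅ (c : Chain X) (_ : c ∈ chainsBetween x z) (_ : c.IsEps ε), c.integral G with hv
  have hvadd : ∀ z z', dist z z' ≤ ε →
      v z' ≤ v z + ENNReal.ofReal ((F z + F z') / 2 * dist z z') := by
    intro z z' hzz
    have hb : ENNReal.ofReal ((F z + F z') / 2 * dist z z') = (G z + G z') / 2 * edist z z' := by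
      have := hF0 z; have := hF0 z'
      rw [ENNReal.ofReal_mul (by positivity), ENNReal.ofReal_div_of_pos two_pos,
        ENNReal.ofReal_add (hF0 z) (hF0 z'), edist_dist, ENNReal.ofReal_ofNat]
    rw [hb]
    refine ENNReal.le_of_forall_pos_le_add fun a ha hfin => ?_
    have hvz : v z < v z + a := by
      have : v z ≠ ∞ := fun h => by simp [h] at hfin
      exact ENNReal.lt_add_right this (by exact_mod_cast ha.ne')
    simp only [hv, iInf_lt_iff] at hvz
    -- A nearly optimal chain to `z`, extended by one edge, competes for `v z'`.
    obtain ⟨c, hc, hcε, hlt⟩ := hvz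
    obtain ⟨c', hc', hcε', he⟩ := Chain.exists_append hc hcε hzz G
    calc v z' ≤ c'.integral G := iInf₂_le_of_le c' hc' (iInf_le _ hcε')
      _ = c.integral G + (G z + G z') / 2 * edist z z' := he
      _ ≤ (v z + a) + (G z + G z') / 2 * edist z z' := by gcongr
      _ = v z + (G z + G z') / 2 * edist z z' + a := by ring
  set u : X → ℝ := fun z => (min 1 (v z)).toReal with hu
  have htop : ∀ z, min 1 (v z) ≠ ∞ := fun z => ((min_le_left _ _).trans_lt ENNReal.one_lt_top).ne
  have hu0 : ∀ z, 0 ≤ u z := fun z => ENNReal.toReal_nonneg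
  have hu1 : ∀ z, u z ≤ 1 := fun z =>
    ENNReal.toReal_le_of_le_ofReal zero_le_one (by simp)
  have huadd : ∀ z z', dist z z' ≤ ε → u z' ≤ u z + (F z + F z') / 2 * dist z z' := by
    intro z z' hzz
    have := hF0 z; have := hF0 z'
    have h1 : min 1 (v z') ≤ min 1 (v z) + ENNReal.ofReal ((F z + F z') / 2 * dist z z') := by
      rw [min_add]
      exact le_min ((min_le_left _ _).trans le_self_add) ((min_le_right _ _).trans (hvadd z z' hzz))
    have h2 := ENNReal.toReal_mono (ENNReal.add_ne_top.2 ⟨htop z, ENNReal.ofReal_ne_top⟩) h1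
    rwa [ENNReal.toReal_add (htop z) ENNReal.ofReal_ne_top,
      ENNReal.toReal_ofReal (by positivity)] at h2
  have huabs : ∀ z z', dist z z' ≤ ε → |u z' - u z| ≤ (F z + F z') / 2 * dist z z' := by
    intro z z' hzz
    have h1 := huadd z z' hzz
    have h2 := huadd z' z (by rwa [dist_comm])
    rw [dist_comm z' z, add_comm (F z')] at h2
    rw [abs_le]
    constructor <;> linarith
  -- `M` serves pairs at distance at most `ε`; for the others `1 / ε` suffices because `u` takes
  -- values in `[0, 1]`.
  refine ⟨u, ⟨M + Real.toNNReal (1 / ε), LipschitzWith.of_dist_le_mul fun z z' => ?_⟩, ?_, ?_⟩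
  · rw [Real.dist_eq, NNReal.coe_add, Real.coe_toNNReal _ (by positivity), add_mul]
    have hd : 0 ≤ dist z z' := dist_nonneg
    have hMd : 0 ≤ M * dist z z' := by positivity
    rcases le_total (dist z z') ε with h | h
    · have h1 := huabs z z' h
      rw [abs_sub_comm] at h1
      have h2 : (F z + F z') / 2 * dist z z' ≤ M * dist z z' := by
        gcongr
        linarith [hFM z, hFM z']
      have h3 : 0 ≤ 1 / ε * dist z z' := by positivity
      linarith
    · have h1 : |u z - u z'| ≤ 1 := by
        rw [abs_le]
        constructor <;> linarith [hu0 z, hu1 z, hu0 z', hu1 z']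
      have h2 : 1 ≤ 1 / ε * dist z z' := by
        rw [one_div_mul_eq_div, le_div_iff₀ hε]; linarith
      linarith
  · have hx : u x = 0 := by
      have : v x = 0 := by
        refine le_antisymm ?_ zero_le
        refine iInf₂_le_of_le (⟨0, fun _ => x⟩ : Chain X) ⟨rfl, rfl⟩ (iInf_le_of_le ?_ ?_)
        · intro i; exact i.elim0
        · simp [Chain.integral]
      simp [hu, this]
    have hy : u y = 1 := by
      have : 1 ≤ v y := le_iInf₂ fun c hc => le_iInf fun hcε => hadm c hc hcε
      simp [hu, this]
    rw [hx, hy]; norm_num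
  · intro z
    refine ENNReal.le_of_forall_pos_le_add fun a ha _ => ?_
    -- Within `r` the one-edge estimate applies and `F` grows by at most `a`; the `+ 1` covers `J =
    -- 0`.
    set r : ℝ := min ε (a / (J + 1)) with hr
    have hr0 : 0 < r := lt_min hε (by positivity)
    refine (iInf₂_le (f := fun ε (_ : 0 < ε) => slope ε u z) r hr0).trans ?_
    refine iSup₂_le fun w hw => ?_
    rw [Metric.mem_ball, dist_comm] at hw
    refine ENNReal.div_le_of_le_mul ?_
    have h1 := huabs z w (hw.le.trans (min_le_left _ _))
    have h2 : F w ≤ F z + a := by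
      have h3 := hF.dist_le_mul w z
      rw [Real.dist_eq, dist_comm w z] at h3
      have h4 : (J : ℝ) * dist z w ≤ J * (a / (J + 1)) := by
        gcongr; exact hw.le.trans (min_le_right _ _)
      have h5 : (J : ℝ) * (a / (J + 1)) ≤ a := by
        rw [mul_div_assoc', div_le_iff₀ (by positivity)]
        have : (0 : ℝ) ≤ a := a.2
        nlinarith
      linarith [le_abs_self (F w - F z)]
    have h6 : ENNReal.ofReal (F z) + (a : ℝ≥0∞) = ENNReal.ofReal (F z + a) := by
      rw [ENNReal.ofReal_add (hF0 z) a.coe_nonneg, ENNReal.ofReal_coe_nnreal]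
    rw [h6, edist_comm, edist_dist, ← ENNReal.ofReal_mul (add_nonneg (hF0 z) a.coe_nonneg)]
    refine ENNReal.ofReal_le_ofReal (h1.trans ?_)
    gcongr
    have : (0 : ℝ) ≤ a := a.2
    linarith

theorem antitone_iInf_shortChains (x y : X) (ℓ : ℝ) (g : X → ℝ≥0∞) (p : ℝ) :
    Antitone fun ε : ℝ => ⨅ c ∈ shortChains ε x y ℓ, c.integral g ^ p := fun _ _ h =>
  biInf_mono fun _ hc => ⟨hc.1, fun i => (hc.2.1 i).trans h, hc.2.2⟩

variable [MeasurableSpace X]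

theorem monotone_chainModulus (p : ℝ) (𝒞 : Set (Chain X)) (F : Set (X → ℝ≥0∞)) (μ : Measure X) :
    Monotone fun ε => chainModulus p ε 𝒞 F μ := fun _ _ h =>
  biInf_mono fun _ hρ => ⟨⟨hρ.1.1, fun c hc hcε => hρ.1.2 c hc fun i => (hcε i).trans h⟩, hρ.2⟩

theorem tendsto_chainModulus (p : ℝ) (𝒞 : Set (Chain X)) (F : Set (X → ℝ≥0∞)) (μ : Measure X) :
    Tendsto (fun ε => chainModulus p ε 𝒞 F μ) (𝓝[>] 0)
      (𝓝 (⨅ ε ∈ Ioi (0 : ℝ), chainModulus p ε 𝒞 F μ)) := by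
  rw [← sInf_image]
  exact (monotone_chainModulus p 𝒞 F μ).tendsto_nhdsGT 0

end Chains

/-! ### Comparison of moduli, and their consequences -/

section Modulus

variable {X : Type*} [PseudoMetricSpace X] [MeasurableSpace X]

/-- An admissible function which is finite at the poles can be replaced by a bounded Lipschitz
function without essentially increasing its energy, at the cost of reducing `ε`. -/
theorem exists_lipschitz_admissible [BorelSpace X] {μ : Measure X} [IsFiniteMeasure μ] {p : ℝ} (hp : 1 ≤ p)
    {x y : X} (hxy : 0 < dist x y) {ε : ℝ} (hε : 0 < ε) {g : X → ℝ≥0∞}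
    (hg : g ∈ admissible ε (chainsBetween x y) ∩ finiteAtPoles x y) {a : ℝ≥0∞}
    (ha : ∫⁻ z, g z ^ p ∂μ < a) :
    ∃ (J M : NNReal) (F : X → ℝ) (ε' : ℝ), 0 < ε' ∧ LipschitzWith J F ∧ (∀ z, 0 ≤ F z) ∧
      (∀ z, F z ≤ M) ∧ ∫⁻ z, ENNReal.ofReal (F z) ^ p ∂μ < a ∧
      ∀ c ∈ chainsBetween x y, c.IsEps ε' →
        1 ≤ c.integral fun z => ENNReal.ofReal (F z) := by
  obtain ⟨⟨hgm, hadm⟩, -, hgx, hgy⟩ := hg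
  have hp0 : 0 ≤ p := zero_le_one.trans hp
  set b : ℕ → NNReal := fun k => 1 / ((k : NNReal) + 1) with hb
  have hb0 : ∀ k, 0 < b k := fun k => by positivity
  have hb1 : ∀ k, b k ≤ 1 := fun k => by
    rw [hb]; exact div_le_one_of_le₀ (by simp) (by positivity)
  have hblim : Tendsto (fun k => (b k : ℝ≥0∞)) atTop (𝓝 0) := by
    rw [← ENNReal.coe_zero, ENNReal.tendsto_coe, ← NNReal.tendsto_coe]
    simpa [hb] using tendsto_one_div_add_atTop_nhds_zero_nat (𝕜 := ℝ)
  -- The added `b k` provides the positive lower bound, and the factor `1 + b k` repairs the loss `θ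
  -- = 1 / (1 + b k)`. Since `μ` is finite, both are free in the limit.
  have hlim : Tendsto (fun k => ∫⁻ z, ((1 + b k : ℝ≥0∞) * (g z + b k)) ^ p ∂μ) atTop
      (𝓝 (∫⁻ z, g z ^ p ∂μ)) := by
    refine tendsto_lintegral_of_dominated_convergence (fun z => (2 * (g z + 1)) ^ p) ?_ ?_ ?_ ?_
    · intro k; fun_prop
    · intro k
      refine Eventually.of_forall fun z => ?_
      have h1 : (b k : ℝ≥0∞) ≤ 1 := by exact_mod_cast hb1 k
      have h2 : (1 + b k : ℝ≥0∞) ≤ 2 := by rw [← one_add_one_eq_two]; gcongr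
      dsimp only
      gcongr
    · have h1 : ∀ z, (2 * (g z + 1)) ^ p ≤ 2 ^ p * (2 ^ (p - 1) * (g z ^ p + 1)) := by
        intro z
        rw [ENNReal.mul_rpow_of_nonneg _ _ hp0]
        gcongr
        simpa using ENNReal.rpow_add_le_mul_rpow_add_rpow (g z) 1 hp
      refine ((lintegral_mono h1).trans_lt ?_).ne
      rw [lintegral_const_mul _ (by fun_prop), lintegral_const_mul _ (by fun_prop),
        lintegral_add_right _ measurable_const]
      refine ENNReal.mul_lt_top (ENNReal.rpow_lt_top_of_nonneg hp0 (by simp))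
        (ENNReal.mul_lt_top (ENNReal.rpow_lt_top_of_nonneg (by linarith) (by simp)) ?_)
      exact ENNReal.add_lt_top.2 ⟨ha.trans_le le_top, by simp⟩
    · refine Eventually.of_forall fun z => ?_
      refine ((ENNReal.continuous_rpow_const (y := p)).tendsto _).comp ?_
      have h1 : Tendsto (fun k => (1 + b k : ℝ≥0∞)) atTop (𝓝 (1 + 0)) := hblim.const_add 1
      have h2 : Tendsto (fun k => g z + (b k : ℝ≥0∞)) atTop (𝓝 (g z + 0)) := hblim.const_add _
      rw [add_zero] at h1 h2
      simpa using ENNReal.Tendsto.mul h1 (Or.inl one_ne_zero) h2 (Or.inr ENNReal.one_ne_top)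
  obtain ⟨k, hk⟩ := (hlim.eventually (gt_mem_nhds ha)).exists
  have hbk : (0 : ℝ) < b k := by exact_mod_cast hb0 k
  obtain ⟨J, F, ε', hε', hFL, hF0, hFJ, hFg, hF⟩ := exists_lipschitz_le_of_admissible hxy hε
    (f := fun z => g z + b k) (ENNReal.add_lt_top.2 ⟨hgx, ENNReal.coe_lt_top⟩)
    (ENNReal.add_lt_top.2 ⟨hgy, ENNReal.coe_lt_top⟩) (hb0 k) (fun z => le_add_self)
    (fun c hc hcε => (hadm c hc hcε).trans (c.integral_mono fun z => le_self_add))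
    (θ := 1 / (1 + b k)) (by positivity) (by rw [div_lt_one (by positivity)]; linarith)
  have hmul : ∀ z, ENNReal.ofReal ((1 + b k) * F z) = (1 + b k : ℝ≥0∞) * ENNReal.ofReal (F z) := by
    intro z
    rw [ENNReal.ofReal_mul (by positivity), ENNReal.ofReal_add zero_le_one hbk.le,
      ENNReal.ofReal_one, ENNReal.ofReal_coe_nnreal]
  refine ⟨(1 + b k) * J, (1 + b k) * J, fun z => (1 + b k) * F z, ε', hε', ?_, ?_, ?_, ?_, ?_⟩
  · refine LipschitzWith.of_dist_le_mul fun z z' => ?_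
    have h1 := hFL.dist_le_mul z z'
    rw [Real.dist_eq] at h1 ⊢
    rw [← mul_sub, abs_mul, abs_of_pos (by positivity)]
    push_cast
    rw [mul_assoc]
    gcongr
  · intro z; have := hF0 z; positivity
  · intro z
    push_cast
    have := hFJ z
    gcongr
  · refine lt_of_le_of_lt (lintegral_mono fun z => ?_) hk
    rw [hmul]
    have := hFg z
    gcongr
  · intro c hc hcε
    simp only [hmul]
    rw [Chain.integral_const_mul]
    have h1 := hF c hc hcε
    calc (1 : ℝ≥0∞) = ENNReal.ofReal ((1 + b k) * (1 / (1 + b k))) := by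
          rw [mul_one_div_cancel (by positivity), ENNReal.ofReal_one]
      _ = (1 + b k : ℝ≥0∞) * ENNReal.ofReal (1 / (1 + b k)) := by
          rw [ENNReal.ofReal_mul (by positivity), ENNReal.ofReal_add zero_le_one hbk.le,
            ENNReal.ofReal_one, ENNReal.ofReal_coe_nnreal]
      _ ≤ _ := by gcongr

/-- The regularization reduces `ε`, so the moduli are compared only after the infimum over all
scales. The reverse inequality is inclusion of classes. -/
theorem iInf_chainModulus_lipClass_eq [BorelSpace X] {μ : Measure X} [IsFiniteMeasure μ] {p : ℝ} (hp : 1 ≤ p)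
    {x y : X} (hxy : 0 < dist x y) :
    ⨅ ε ∈ Ioi (0 : ℝ), chainModulus p ε (chainsBetween x y) (lipClass X) μ =
      ⨅ ε ∈ Ioi (0 : ℝ), chainModulus p ε (chainsBetween x y) (finiteAtPoles x y) μ := by
  apply le_antisymm
  · refine le_iInf₂ fun ε hε => le_iInf₂ fun g hg => le_of_forall_gt fun a ha => ?_
    obtain ⟨J, M, F, ε', hε', hFL, hF0, -, hlt, hF⟩ :=
      exists_lipschitz_admissible hp hxy (mem_Ioi.1 hε) hg ha
    refine lt_of_le_of_lt (iInf₂_le_of_le ε' hε' ?_) hlt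
    refine iInf₂_le (f := fun (ρ : X → ℝ≥0∞)
      (_ : ρ ∈ admissible ε' (chainsBetween x y) ∩ lipClass X) => ∫⁻ z, ρ z ^ p ∂μ)
      (fun z => ENNReal.ofReal (F z)) ⟨⟨?_, hF⟩, F, hF0, ⟨J, hFL⟩, fun _ => rfl⟩
    exact hFL.continuous.measurable.ennreal_ofReal
  · refine iInf₂_mono fun ε _ => biInf_mono ?_
    rintro ρ ⟨h, F, -, -, hF⟩
    exact ⟨h, h.1, by rw [hF]; exact ENNReal.ofReal_lt_top, by rw [hF]; exact ENNReal.ofReal_lt_top⟩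

/-- The estimate for Lipschitz functions bounds the modulus from below. -/
theorem inv_le_iInf_chainModulus [BorelSpace X] {μ : Measure X} [IsFiniteMeasure μ] {p : ℝ} (hp : 1 ≤ p)
    {x y : X} (hxy : 0 < dist x y) {C : ℝ≥0∞}
    (h : ∀ u : X → ℝ, (∃ K, LipschitzWith K u) →
      ENNReal.ofReal |u x - u y| ^ p ≤ C * ∫⁻ z, lip u z ^ p ∂μ) :
    C⁻¹ ≤ ⨅ ε ∈ Ioi (0 : ℝ), chainModulus p ε (chainsBetween x y) (finiteAtPoles x y) μ := by
  refine le_iInf₂ fun ε hε => le_iInf₂ fun g hg => le_of_forall_gt_imp_ge_of_dense fun a ha => ?_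
  obtain ⟨J, M, F, ε', hε', hFL, hF0, hFM, hlt, hF⟩ :=
    exists_lipschitz_admissible hp hxy (mem_Ioi.1 hε) hg ha
  obtain ⟨u, hu, hu1, hlip⟩ := exists_lipschitz_lip_le hFL hF0 hFM hε' hF
  have h1 := h u hu
  rw [hu1, ENNReal.ofReal_one, ENNReal.one_rpow] at h1
  have h2 : ∫⁻ z, lip u z ^ p ∂μ ≤ ∫⁻ z, ENNReal.ofReal (F z) ^ p ∂μ :=
    lintegral_mono fun z => ENNReal.rpow_le_rpow (hlip z) (by linarith)
  have h3 : 1 ≤ C * a := h1.trans (by gcongr; exact h2.trans hlt.le)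
  exact (ENNReal.inv_le_iff_le_mul (fun _ hC => by simp [hC] at h3)
    (fun _ ha0 => by simp [ha0] at ha)).2 h3

/-- A lower bound of the modulus yields short chains with small integral. -/
theorem exists_iInf_shortChains_le {μ : Measure X} [IsFiniteMeasure μ] {p : ℝ} (hp : 1 ≤ p)
    {x y : X} {κ : ℝ≥0∞} (hκ0 : κ ≠ 0) (hκ : κ ≠ ∞)
    (h : ∀ ε : ℝ, 0 < ε → κ ≤ chainModulus p ε (chainsBetween x y) (finiteAtPoles x y) μ) :
    ∃ A ℓ : ℝ, 0 < A ∧ ∀ g : X → ℝ≥0∞, Measurable g → g x < ∞ → g y < ∞ → ∀ ε : ℝ, 0 < ε →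
      ⨅ c ∈ shortChains ε x y ℓ, c.integral g ^ p ≤ ENNReal.ofReal A * ∫⁻ z, g z ^ p ∂μ := by
  have hp0 : 0 < p := by linarith
  set V := μ univ with hV
  have hVtop : V ≠ ∞ := measure_ne_top _ _
  have h2top : (2 : ℝ≥0∞) ^ (p - 1) ≠ ∞ := (ENNReal.rpow_lt_top_of_nonneg (by linarith) (by simp)).ne
  have h2zero : (2 : ℝ≥0∞) ^ (p - 1) ≠ 0 := by simp [ENNReal.rpow_eq_zero_iff]
  -- Chosen so that the test function `ρ` below has energy at most `κ / 2`; the power of 2 comes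
  -- from convexity and `V` from the added constant.
  set B : ℝ≥0∞ := 2 * (κ⁻¹ * (2 ^ (p - 1) * (1 + V))) with hB
  have hB0 : B ≠ 0 := by
    simp [hB, hκ, h2zero]
  have hBtop : B ≠ ∞ := by
    refine ENNReal.mul_ne_top (by simp) (ENNReal.mul_ne_top (by simpa using hκ0)
      (ENNReal.mul_ne_top h2top (by simp [hVtop])))
  have hBp0 : B ^ (1 / p) ≠ 0 := by simp [ENNReal.rpow_eq_zero_iff, hB0, hBtop]
  have hBptop : B ^ (1 / p) ≠ ∞ := (ENNReal.rpow_lt_top_of_nonneg (by positivity) hBtop).ne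
  refine ⟨B.toReal, (B ^ (1 / p)).toReal, ENNReal.toReal_pos hB0 hBtop, ?_⟩
  intro g hg hgx hgy ε hε
  rw [ENNReal.ofReal_toReal hBtop]
  set I := ∫⁻ z, g z ^ p ∂μ with hI
  -- A strict upper bound `s` replaces the energy `I`, which may vanish, so that one can divide by
  -- it.
  have key : ∀ s, I < s → s ≠ ∞ → ⨅ c ∈ shortChains ε x y (B ^ (1 / p)).toReal,
      c.integral g ^ p ≤ B * s := by
    intro s hs hsfin
    have hs0 : s ≠ 0 := (zero_le.trans_lt hs).ne'
    set l := s ^ (1 / p) with hl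
    have hlp : l ^ p = s := by rw [hl, ← ENNReal.rpow_mul]; simp [hp0.ne']
    have hl0 : l ≠ 0 := by simp [hl, ENNReal.rpow_eq_zero_iff, hs0, hsfin]
    have hltop : l ≠ ∞ := (ENNReal.rpow_lt_top_of_nonneg (by positivity) hsfin).ne
    set t := B ^ (1 / p) * l with ht
    have htp : t ^ p = B * s := by
      rw [ht, ENNReal.mul_rpow_of_nonneg _ _ hp0.le, hlp, ← ENNReal.rpow_mul]; simp [hp0.ne']
    have ht0 : t ≠ 0 := mul_ne_zero hBp0 hl0
    have httop : t ≠ ∞ := ENNReal.mul_ne_top hBptop hltop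
    set ρ : X → ℝ≥0∞ := fun z => t⁻¹ * (g z + l) with hρ
    have hρm : Measurable ρ := by fun_prop
    have hlt : ∫⁻ z, ρ z ^ p ∂μ < κ := by
      have h1 : ∫⁻ z, ρ z ^ p ∂μ ≤ (B * s)⁻¹ * (2 ^ (p - 1) * (s * (1 + V))) := by
        calc ∫⁻ z, ρ z ^ p ∂μ
            ≤ ∫⁻ z, (B * s)⁻¹ * (2 ^ (p - 1) * (g z ^ p + s)) ∂μ := by
              refine lintegral_mono fun z => ?_
              rw [hρ]
              dsimp only
              rw [ENNReal.mul_rpow_of_nonneg _ _ hp0.le, ENNReal.inv_rpow, htp]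
              gcongr
              simpa [hlp] using ENNReal.rpow_add_le_mul_rpow_add_rpow (g z) l hp
          _ = (B * s)⁻¹ * (2 ^ (p - 1) * (I + s * V)) := by
              rw [lintegral_const_mul _ (by fun_prop), lintegral_const_mul _ (by fun_prop),
                lintegral_add_right _ measurable_const, lintegral_const]
          _ ≤ _ := by
              rw [mul_add s, mul_one]
              gcongr
      refine h1.trans_lt ?_
      have h2 : (B * s)⁻¹ * (2 ^ (p - 1) * (s * (1 + V))) = κ / 2 := by
        have hW0 : 2 ^ (p - 1) * (1 + V) ≠ 0 := mul_ne_zero h2zero (by simp)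
        have hWtop : 2 ^ (p - 1) * (1 + V) ≠ ∞ := ENNReal.mul_ne_top h2top (by simp [hVtop])
        rw [hB]
        generalize hW : 2 ^ (p - 1) * (1 + V) = W at *
        calc (2 * (κ⁻¹ * W) * s)⁻¹ * (2 ^ (p - 1) * (s * (1 + V)))
            = (2 * (κ⁻¹ * W) * s)⁻¹ * (W * s) := by rw [← hW]; ring
          _ = 2⁻¹ * κ * (W⁻¹ * W) * (s⁻¹ * s) := by
              rw [ENNReal.mul_inv (by simp [hsfin]) (by simp [hs0]),
                ENNReal.mul_inv (by simp) (by simp),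
                ENNReal.mul_inv (by simp [hWtop]) (by simp [hW0]), inv_inv]
              ring
          _ = κ / 2 := by
              rw [ENNReal.inv_mul_cancel hW0 hWtop, ENNReal.inv_mul_cancel hs0 hsfin, mul_one,
                mul_one, ENNReal.div_eq_inv_mul]
      rw [h2]
      exact ENNReal.half_lt_self hκ0 hκ
    have hnot : ρ ∉ admissible ε (chainsBetween x y) := by
      intro hadm
      have hfin : ∀ z, g z < ∞ → ρ z < ∞ := fun z hz =>
        ENNReal.mul_lt_top (ENNReal.inv_lt_top.2 ht0.bot_lt)
          (ENNReal.add_lt_top.2 ⟨hz, hltop.lt_top⟩)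
      exact absurd ((h ε hε).trans (iInf₂_le (f := fun (ρ : X → ℝ≥0∞)
        (_ : ρ ∈ admissible ε (chainsBetween x y) ∩ finiteAtPoles x y) => ∫⁻ z, ρ z ^ p ∂μ)
        ρ ⟨hadm, hρm, hfin x hgx, hfin y hgy⟩)) (not_le.2 hlt)
    simp only [admissible, mem_ofPred_eq, not_and, not_forall, not_le] at hnot
    obtain ⟨c, hc, hcε, hc1⟩ := hnot hρm
    rw [hρ, Chain.integral_const_mul, ← ENNReal.div_eq_inv_mul,
      ENNReal.div_lt_iff (Or.inl ht0) (Or.inl httop), one_mul] at hc1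
    -- The constant `l` in `g + l` charges for length; as `t` is proportional to `l`, the resulting
    -- bound does not depend on `g`.
    have hlen : c.length ≤ B ^ (1 / p) := by
      have h1 := c.mul_length_le_integral (g := fun z => g z + l) (a := l) fun z => le_add_self
      have h2 : l * c.length ≤ l * B ^ (1 / p) := by
        rw [mul_comm l (B ^ (1 / p))]; exact h1.trans hc1.le
      exact (ENNReal.mul_le_mul_iff_right hl0 hltop).1 h2
    refine (iInf₂_le (f := fun (c : Chain X) (_ : c ∈ shortChains ε x y (B ^ (1 / p)).toReal) =>
      c.integral g ^ p) c ⟨hc, hcε, by rwa [ENNReal.ofReal_toReal hBptop]⟩).trans ?_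
    rw [← htp]
    exact ENNReal.rpow_le_rpow ((c.integral_mono fun z => le_self_add).trans hc1.le) hp0.le
  rw [mul_comm, ← ENNReal.div_le_iff_le_mul (Or.inl hB0) (Or.inl hBtop)]
  refine le_of_forall_gt_imp_ge_of_dense fun s hs => ?_
  rcases eq_or_ne s ∞ with rfl | hsfin
  · exact le_top
  · rw [ENNReal.div_le_iff_le_mul (Or.inl hB0) (Or.inl hBtop), mul_comm]
    exact key s hs hsfin

end Modulus

/-- Slopes decrease to `lip u` with the radius and are dominated by the Lipschitz constant, which is
integrable on a finite measure space. -/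
theorem tendsto_lintegral_slope_rpow {X : Type*} [MetricSpace X] [MeasurableSpace X] [BorelSpace X]
    {μ : Measure X} [IsFiniteMeasure μ] {p : ℝ} (hp : 0 ≤ p) {u : X → ℝ} {K : NNReal}
    (hu : LipschitzWith K u) :
    Tendsto (fun k : ℕ => ∫⁻ z, slope (1 / ((k : ℝ) + 1)) u z ^ p ∂μ) atTop
      (𝓝 (∫⁻ z, lip u z ^ p ∂μ)) := by
  refine tendsto_lintegral_of_dominated_convergence (fun _ => (K : ℝ≥0∞) ^ p) ?_ ?_ ?_ ?_
  · exact fun k => (lowerSemicontinuous_slope hu.continuous _).measurable.pow_const p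
  · exact fun k => Eventually.of_forall fun z =>
      ENNReal.rpow_le_rpow (slope_le_of_lipschitz hu _ z) hp
  · rw [lintegral_const]
    exact ENNReal.mul_ne_top (ENNReal.rpow_lt_top_of_nonneg hp ENNReal.coe_ne_top).ne
      (measure_ne_top _ _)
  · refine Eventually.of_forall fun z => ((ENNReal.continuous_rpow_const (y := p)).tendsto _).comp ?_
    have h1 : Antitone fun k : ℕ => slope (1 / ((k : ℝ) + 1)) u z := fun i j hij =>
      slope_mono u z (by gcongr)
    have h2 : lip u z = ⨅ k : ℕ, slope (1 / ((k : ℝ) + 1)) u z := by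
      apply le_antisymm
      · exact le_iInf fun k => iInf₂_le (f := fun ε (_ : 0 < ε) => slope ε u z) _ (by positivity)
      · refine le_iInf₂ fun ε hε => ?_
        obtain ⟨k, hk⟩ := exists_nat_one_div_lt hε
        exact iInf_le_of_le k (slope_mono u z hk.le)
    rw [h2]
    exact tendsto_atTop_iInf h1

end ChainPI

/-! ### The cycle of implications -/

theorem mainTheorem11 {X : Type*} [MetricSpace X] [TopologicalSpace.SeparableSpace X]
    [MeasurableSpace X] [BorelSpace X] (m : Measure X) [m.Regular] (hm0 : m ≠ 0)
    (hmb : ∀ s : Set X, Bornology.IsBounded s → m s < ∞)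
    (hmd : ChainPI.IsDoubling m) (p : ℝ) (hp : 1 ≤ p) (x y : X) :
    List.TFAE
      [ -- pointwise estimate for Lipschitz functions and their local Lipschitz constant
        ∃ C L : ℝ, 0 < C ∧ 1 ≤ L ∧
          ∀ u : X → ℝ, (∃ K, LipschitzWith K u) →
            ENNReal.ofReal |u x - u y| ^ p ≤
              ENNReal.ofReal C * edist x y ^ (p - 1) *
                ∫⁻ z, ChainPI.lip u z ^ p ∂(ChainPI.rieszMeasure m L x y),
        -- existence of short chains with small integral
        ∃ C L : ℝ, 0 < C ∧ 1 ≤ L ∧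
          ∀ g : X → ℝ≥0∞, Measurable g → g x < ∞ → g y < ∞ →
            ∃ l : ℝ≥0∞,
              Tendsto
                (fun ε : ℝ => ⨅ c ∈ ChainPI.shortChains ε x y (C * dist x y), c.integral g ^ p)
                (𝓝[>] 0) (𝓝 l) ∧
              l ≤ ENNReal.ofReal C * edist x y ^ (p - 1) *
                ∫⁻ z, g z ^ p ∂(ChainPI.rieszMeasure m L x y),
        -- pointwise estimate for Borel functions and their chain upper gradients
        ∃ C L : ℝ, 0 < C ∧ 1 ≤ L ∧
          ∀ u : X → ℝ, Measurable u → ∀ ε : ℝ, 0 < ε →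
            ∀ g : X → ℝ≥0∞, ChainPI.IsChainUpperGradient ε u g → g x < ∞ → g y < ∞ →
              ENNReal.ofReal |u x - u y| ^ p ≤
                ENNReal.ofReal C * edist x y ^ (p - 1) *
                  ∫⁻ z, g z ^ p ∂(ChainPI.rieszMeasure m L x y),
        -- equality of the two limits of chain moduli, and lower bound
        ∃ c L : ℝ, 0 < c ∧ 1 ≤ L ∧
          ∃ l : ℝ≥0∞,
            Tendsto
              (fun ε : ℝ => ChainPI.chainModulus p ε (ChainPI.chainsBetween x y)
                (ChainPI.finiteAtPoles x y) (ChainPI.rieszMeasure m L x y))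
              (𝓝[>] 0) (𝓝 l) ∧
            Tendsto
              (fun ε : ℝ => ChainPI.chainModulus p ε (ChainPI.chainsBetween x y)
                (ChainPI.lipClass X) (ChainPI.rieszMeasure m L x y))
              (𝓝[>] 0) (𝓝 l) ∧
            ENNReal.ofReal c * edist x y ^ (1 - p) ≤ l ] := by
  have hp0 : 0 < p := by linarith
  have hfin : ∀ L, IsFiniteMeasure (ChainPI.rieszMeasure m L x y) := fun L =>
    ChainPI.isFiniteMeasure_rieszMeasure hmd L x y
  rcases eq_or_ne x y with rfl | hxy
  -- For `x = y` the one-point chain has integral 0: nothing is admissible, the moduli are `∞`, and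
  -- all four conditions hold.
  · have hc : (⟨0, fun _ => x⟩ : ChainPI.Chain X) ∈ ChainPI.chainsBetween x x := ⟨rfl, rfl⟩
    have hcε : ∀ ε, (⟨0, fun _ => x⟩ : ChainPI.Chain X).IsEps ε := fun ε i => i.elim0
    have hci : ∀ g, (⟨0, fun _ => x⟩ : ChainPI.Chain X).integral g = 0 := fun g => by
      simp [ChainPI.Chain.integral]
    have hmod : ∀ ε F μ, ChainPI.chainModulus p ε (ChainPI.chainsBetween x x) F μ = ∞ := by
      intro ε F μ
      refine iInf₂_eq_top.2 fun ρ hρ => ?_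
      have := hρ.1.2 _ hc (hcε ε)
      simp [hci] at this
    refine List.tfae_of_forall True _ fun a ha => ?_
    simp only [List.mem_cons, List.not_mem_nil, or_false] at ha
    rw [iff_true]
    rcases ha with rfl | rfl | rfl | rfl
    · exact ⟨1, 1, one_pos, le_rfl, fun u _ => by simp [hp0]⟩
    · refine ⟨1, 1, one_pos, le_rfl, fun g _ _ _ => ⟨0, ?_, zero_le⟩⟩
      refine tendsto_const_nhds.congr fun ε => (le_antisymm ?_ zero_le).symm
      refine iInf₂_le_of_le (⟨0, fun _ => x⟩ : ChainPI.Chain X) ⟨hc, hcε ε, ?_⟩ ?_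
      · simp [ChainPI.Chain.length]
      · rw [hci, ENNReal.zero_rpow_of_pos hp0]
    · exact ⟨1, 1, one_pos, le_rfl, fun u _ ε _ g _ _ _ => by simp [hp0]⟩
    · refine ⟨1, 1, one_pos, le_rfl, ∞, ?_, ?_, le_top⟩ <;>
        simp only [hmod] <;> exact tendsto_const_nhds
  have hD : 0 < dist x y := dist_pos.2 hxy
  have he0 : edist x y ≠ 0 := (edist_pos.2 hxy).ne'
  have hetop : edist x y ≠ ∞ := edist_ne_top x y
  have hep0 : ∀ a : ℝ, edist x y ^ a ≠ 0 := fun a => by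
    simp [ENNReal.rpow_eq_zero_iff, he0, hetop]
  have heptop : ∀ a : ℝ, edist x y ^ a ≠ ∞ := fun a => by
    simp [ENNReal.rpow_eq_top_iff, he0, hetop]
  tfae_have 1 → 4 := by
    rintro ⟨C, L, hC, hL, h⟩
    refine ⟨C⁻¹, L, by positivity, hL, _, ChainPI.tendsto_chainModulus _ _ _ _, ?_, ?_⟩
    · rw [← ChainPI.iInf_chainModulus_lipClass_eq hp hD]
      exact ChainPI.tendsto_chainModulus _ _ _ _
    · refine le_trans (le_of_eq ?_) (ChainPI.inv_le_iInf_chainModulus hp hD h)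
      rw [ENNReal.mul_inv (Or.inr (heptop _)) (Or.inr (hep0 _)), ← ENNReal.rpow_neg, neg_sub,
        ENNReal.ofReal_inv_of_pos hC]
  tfae_have 4 → 2 := by
    rintro ⟨c, L, hc, hL, l, hl, -, hcl⟩
    have hl' := tendsto_nhds_unique hl (ChainPI.tendsto_chainModulus _ _ _ _)
    obtain ⟨A, ℓ, hA, h⟩ := ChainPI.exists_iInf_shortChains_le
      (μ := ChainPI.rieszMeasure m L x y) (x := x) (y := y) hp
      (mul_ne_zero (by simpa using hc) (hep0 (1 - p)))
      (ENNReal.mul_ne_top ENNReal.ofReal_ne_top (heptop (1 - p)))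
      (fun ε hε => hcl.trans (hl'.le.trans (iInf₂_le ε hε)))
    set E : ℝ := (edist x y ^ (p - 1)).toReal with hE
    have hE0 : 0 < E := ENNReal.toReal_pos (hep0 _) (heptop _)
    -- The same constant has to serve as energy factor and as length bound.
    set C : ℝ := max (A / E) (ℓ / dist x y) with hC
    refine ⟨C, L, lt_max_of_lt_left (by positivity), hL, fun g hg hgx hgy =>
      ⟨_, (ChainPI.antitone_iInf_shortChains x y _ g p).tendsto_nhdsGT 0, ?_⟩⟩
    refine sSup_le ?_
    rintro _ ⟨ε, hε, rfl⟩
    have h1 : ℓ ≤ C * dist x y := (div_le_iff₀ hD).1 (le_max_right _ _)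
    have h2 : ENNReal.ofReal A ≤ ENNReal.ofReal C * edist x y ^ (p - 1) := by
      rw [← ENNReal.ofReal_toReal (heptop (p - 1)), ← ENNReal.ofReal_mul' hE0.le]
      exact ENNReal.ofReal_le_ofReal ((div_le_iff₀ hE0).1 (le_max_left _ _))
    calc ⨅ c ∈ ChainPI.shortChains ε x y (C * dist x y), c.integral g ^ p
        ≤ ⨅ c ∈ ChainPI.shortChains ε x y ℓ, c.integral g ^ p :=
          biInf_mono fun c hc => ⟨hc.1, hc.2.1, hc.2.2.trans (ENNReal.ofReal_le_ofReal h1)⟩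
      _ ≤ ENNReal.ofReal A * ∫⁻ z, g z ^ p ∂(ChainPI.rieszMeasure m L x y) :=
          h g hg hgx hgy ε hε
      _ ≤ _ := by gcongr
  tfae_have 2 → 3 := by
    rintro ⟨C, L, hC, hL, h⟩
    refine ⟨C, L, hC, hL, fun u _ ε hε g hg hgx hgy => ?_⟩
    obtain ⟨l, hl, hle⟩ := h g hg.1 hgx hgy
    refine le_trans (ge_of_tendsto hl ?_) hle
    filter_upwards [Ioo_mem_nhdsGT hε] with ε' hε'
    refine le_iInf₂ fun c hc => ENNReal.rpow_le_rpow ?_ hp0.le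
    have := hg.2 c fun i => (hc.2.1 i).trans hε'.2.le
    rwa [hc.1.1, hc.1.2, abs_sub_comm] at this
  tfae_have 3 → 1 := by
    rintro ⟨C, L, hC, hL, h⟩
    refine ⟨C, L, hC, hL, fun u ⟨K, hu⟩ => ?_⟩
    refine ge_of_tendsto' (ENNReal.Tendsto.const_mul
      (ChainPI.tendsto_lintegral_slope_rpow hp0.le hu) (Or.inr
        (ENNReal.mul_ne_top ENNReal.ofReal_ne_top (heptop _)))) fun k => ?_
    have hk : (0 : ℝ) < 1 / ((k : ℝ) + 1) := by positivity
    -- Half the slope radius is a chain scale strictly below it.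
    exact h u hu.continuous.measurable _ (half_pos hk) _
      (ChainPI.isChainUpperGradient_slope hu.continuous (half_lt_self hk))
      ((ChainPI.slope_le_of_lipschitz hu _ _).trans_lt ENNReal.coe_lt_top)
      ((ChainPI.slope_le_of_lipschitz hu _ _).trans_lt ENNReal.coe_lt_top)
  tfae_finish
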